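/- Let $k$ be a field and $\mathcal{A}$ an essentially small additive category which is $k$-trivial: for all objects $x,y$ of $\mathcal{A}$ the abelian group $\mathcal{A}(x,y)$ is finite, of order invertible in $k$. Let $\mathbf{Rep}(\mathcal{A})$ be the category of additive functors from $\mathcal{A}$ to abelian groups and $\mathcal{F}(\mathcal{A};k)$ the category of all functors from $\mathcal{A}$ to $k$-vector spaces. For $A$ in $\mathbf{Rep}(\mathcal{A})$, let $k[A]$ in $\mathcal{F}(\mathcal{A};k)$ be the functor $a\mapsto k[A(a)]$, the $k$-vector space with basis the set $A(a)$, and put $$\mathrm{Q}_A=\mathrm{Coker}\Big(\bigoplus_{B\subsetneq A}k[B]\to k[A]\Big),\qquad \mathrm{Q}^A=\mathrm{Ker}\Big(k[A]\to\prod_{0\neq B\subseteq A}k[A/B]\Big),$$ where $B$ runs over subfunctors of $A$ in $\mathbf{Rep}(\mathcal{A})$; the group $\mathrm{Aut}(A)$ acts on both. For a $k[\mathrm{Aut}(A)]$-module $M$, let $\mathrm{Q}(A,M)$ be the image of the morphism $$M\otimes_{k[\mathrm{Aut}(A)]}\mathrm{Q}^A\to M\otimes_{k[\mathrm{Aut}(A)]}\mathrm{Q}_A$$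 of $\mathcal{F}(\mathcal{A};k)$ induced by the canonical composite $\mathrm{Q}^A\hookrightarrow k[A]\twoheadrightarrow \mathrm{Q}_A$; here $M\otimes_{k[\mathrm{Aut}(A)]}X$ denotes the coinvariants $(M\otimes_k X)_{\mathrm{Aut}(A)}$ of the diagonal action. An object of an abelian category has finite length if it is artinian and noetherian. Then, for every $A$ in $\mathbf{Rep}(\mathcal{A})$, the functor $k[A]$ has finite length in $\mathcal{F}(\mathcal{A};k)$ if and only if $A$ has finite length in $\mathbf{Rep}(\mathcal{A})$. In that case, a functor $S$ in $\mathcal{F}(\mathcal{A};k)$ is isomorphic to a composition factor of $k[A]$ if and only if $S\simeq\mathrm{Q}(B,M)$ for some subquotient $B$ of $A$ in $\mathbf{Rep}(\mathcal{A})$ and some simple $k[\mathrm{Aut}(B)]$-module $M$. -/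

import Mathlib

open CategoryTheory CategoryTheory.Limits

universe w v u

noncomputable section

namespace AddRepLin

section Generalities

variable {C : Type u} [Category.{v} C]

/-- An object has finite length if it is both artinian and noetherian. -/
def IsFiniteLength (X : C) : Prop :=
  IsArtinianObject X ∧ IsNoetherianObject X

/-- `Y` is a subquotient of `X`: a quotient of a subobject of `X`. -/
def IsSubquotient (Y X : C) : Prop :=
  ∃ (Z : C) (i : Z ⟶ X) (p : Z ⟶ Y), Mono i ∧ Epi p

variable [Abelian C]

/-- A finite chain `0 = X₀ ≤ X₁ ≤ ⋯ ≤ Xₙ = X` of subobjects whose successive quotients are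
simple. -/
structure CompSeries (X : C) where
  /-- the number of steps -/
  length : ℕ
  /-- the members of the chain -/
  sub : Fin (length + 1) → Subobject X
  sub_zero : sub 0 = ⊥
  sub_last : sub (Fin.last length) = ⊤
  le_succ : ∀ i : Fin length, sub i.castSucc ≤ sub i.succ
  simple : ∀ i : Fin length, Simple (cokernel (Subobject.ofLE _ _ (le_succ i)))

/-- The `i`-th successive quotient of a composition series. -/
def CompSeries.factor {X : C} (s : CompSeries X) (i : Fin s.length) : C :=
  cokernel (Subobject.ofLE _ _ (s.le_succ i))

/-- `S` is (up to isomorphism) a composition factor of `X`. By the Jordan-Hölder theorem it does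
not matter which composition series is used. -/
def IsCompositionFactor (S X : C) : Prop :=
  ∃ (s : CompSeries X) (i : Fin s.length), Nonempty (S ≅ s.factor i)

end Generalities

variable (k : Type w) [Field k] {𝒜 : Type u} [Category.{v} 𝒜] [Preadditive 𝒜]

variable (𝒜) in
/-- `𝒜` is `k`-trivial: its Hom groups are finite, of order invertible in `k`. -/
def IsTrivialFor : Prop :=
  ∀ x y : 𝒜, Finite (x ⟶ y) ∧ IsUnit (Nat.card (x ⟶ y) : k)

/-- The linearization `k[A] : a ↦ k[A(a)]` of an additive functor `A`, an object of the category
of all functors from `𝒜` to `k`-vector spaces. -/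
def linearization (A : 𝒜 ⥤+ AddCommGrpCat.{w}) : 𝒜 ⥤ ModuleCat.{w} k :=
  A.obj ⋙ forget AddCommGrpCat.{w} ⋙ ModuleCat.free k

/-- A subfunctor of an additive functor `A`, with values in abelian groups. -/
structure AddSubfunctor (A : 𝒜 ⥤+ AddCommGrpCat.{w}) where
  /-- the value of the subfunctor -/
  obj (a : 𝒜) : AddSubgroup (A.obj.obj a)
  map_mem {a b : 𝒜} (f : a ⟶ b) {x : A.obj.obj a} (hx : x ∈ obj a) :
    (A.obj.map f).hom x ∈ obj b

namespace AddSubfunctor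

variable {A : 𝒜 ⥤+ AddCommGrpCat.{w}}

/-- `B ⊊ A`. -/
def IsProper (B : AddSubfunctor A) : Prop := ∃ a, B.obj a ≠ ⊤

/-- `B ≠ 0`. -/
def IsNonzero (B : AddSubfunctor A) : Prop := ∃ a, B.obj a ≠ ⊥

/-- The inverse image of a subfunctor under an endomorphism. -/
def comap (B : AddSubfunctor A) (g : A ⟶ A) : AddSubfunctor A where
  obj a := (B.obj a).comap (g.hom.app a).hom
  map_mem {a b} f {x} hx := by
    have h := ConcreteCategory.congr_hom (g.hom.naturality f) x
    have h' := B.map_mem f (AddSubgroup.mem_comap.1 hx)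
    rw [AddSubgroup.mem_comap]
    simp only [ConcreteCategory.comp_apply] at h
    exact (congrArg (· ∈ B.obj b) h).mpr h'

end AddSubfunctor

variable (A : 𝒜 ⥤+ AddCommGrpCat.{w})

/-- `k[A(a)] → k[A(a)]` induced by an endomorphism of `A`. -/
def linEnd (g : A ⟶ A) (a : 𝒜) : (A.obj.obj a →₀ k) →ₗ[k] (A.obj.obj a →₀ k) :=
  Finsupp.lmapDomain k k (g.hom.app a).hom

/-- `k[A(a)] → k[A(b)]` induced by a morphism `a ⟶ b` of `𝒜`. -/
def linMap {a b : 𝒜} (f : a ⟶ b) : (A.obj.obj a →₀ k) →ₗ[k] (A.obj.obj b →₀ k) :=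
  Finsupp.lmapDomain k k (A.obj.map f).hom

/-- The (left) action of the group `Aut(A)` on `k[A(a)]`. -/
def linRep (a : 𝒜) : Representation k (Aut A) (A.obj.obj a →₀ k) where
  toFun g := linEnd k A g.hom a
  map_one' := by
    ext x : 2
    simp only [linEnd, LinearMap.comp_apply, Finsupp.lsingle_apply, Finsupp.lmapDomain_apply,
      Finsupp.mapDomain_single]
    rfl
  map_mul' g h := by
    ext x : 2
    simp only [linEnd, LinearMap.comp_apply, Module.End.mul_apply, Finsupp.lsingle_apply,
      Finsupp.lmapDomain_apply, Finsupp.mapDomain_single]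
    rfl

/-- The value at `a` of the image of `⨁ k[B] → k[A]`, the sum being over all `B ⊊ A`. -/
def properSum (a : 𝒜) : Submodule k (A.obj.obj a →₀ k) :=
  ⨆ (B : AddSubfunctor A) (_ : B.IsProper),
    LinearMap.range (Finsupp.lmapDomain k k (B.obj a).subtype)

/-- The value at `a` of the kernel of `k[A] → ∏ k[A/B]`, the product being over all
`0 ≠ B ⊆ A`. -/
def quotKer (a : 𝒜) : Submodule k (A.obj.obj a →₀ k) :=
  ⨅ (B : AddSubfunctor A) (_ : B.IsNonzero),
    LinearMap.ker (Finsupp.lmapDomain k k (QuotientAddGroup.mk' (B.obj a)))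

lemma lmapDomain_range_le {S T S' T' : Type w} (i : S → T) (i' : S' → T') (φ : T → T')
    (ψ : S → S') (h : ∀ x, φ (i x) = i' (ψ x)) :
    LinearMap.range (Finsupp.lmapDomain k k i) ≤
      (LinearMap.range (Finsupp.lmapDomain k k i')).comap (Finsupp.lmapDomain k k φ) := by
  rintro _ ⟨y, rfl⟩
  refine ⟨Finsupp.lmapDomain k k ψ y, ?_⟩
  simp only [Finsupp.lmapDomain_apply, ← Finsupp.mapDomain_comp]
  exact congrArg (fun m => Finsupp.mapDomain m y) (funext fun x => (h x).symm)

lemma lmapDomain_ker_le {S T S' T' : Type w} (p : S → T) (p' : S' → T') (φ : S → S')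
    (ψ : T → T') (h : ∀ x, p' (φ x) = ψ (p x)) :
    LinearMap.ker (Finsupp.lmapDomain k k p) ≤
      (LinearMap.ker (Finsupp.lmapDomain k k p')).comap (Finsupp.lmapDomain k k φ) := by
  intro y hy
  simp only [LinearMap.mem_ker, Submodule.mem_comap, Finsupp.lmapDomain_apply,
    ← Finsupp.mapDomain_comp] at hy ⊢
  rw [show p' ∘ φ = ψ ∘ p from funext h, Finsupp.mapDomain_comp, hy, Finsupp.mapDomain_zero]

lemma properSum_le_comap_linEnd (g : Aut A) (a : 𝒜) :
    properSum k A a ≤ (properSum k A a).comap (linRep k A a g) := by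
  have hg : ∀ (b : 𝒜) (x : A.obj.obj b), (g.inv.hom.app b).hom ((g.hom.hom.app b).hom x) = x :=
    fun b x => ConcreteCategory.congr_hom
      (congrArg (fun h : A ⟶ A => h.hom.app b) g.hom_inv_id) x
  refine iSup₂_le fun B hB => ?_
  have hB' : (B.comap g.inv).IsProper := by
    obtain ⟨b, hb⟩ := hB
    refine ⟨b, fun h => hb ((AddSubgroup.eq_top_iff' _).2 fun x => ?_)⟩
    have := (AddSubgroup.eq_top_iff' _).1 h ((g.hom.hom.app b).hom x)
    rw [← hg b x]
    exact this
  refine (lmapDomain_range_le k (B.obj a).subtype ((B.comap g.inv).obj a).subtype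
    (g.hom.hom.app a).hom (fun x : B.obj a => ⟨(g.hom.hom.app a).hom x.1, ?_⟩)
    fun x => rfl).trans (Submodule.comap_mono (le_iSup₂
      (f := fun (B : AddSubfunctor A) (_ : B.IsProper) =>
        LinearMap.range (Finsupp.lmapDomain k k (B.obj a).subtype)) (B.comap g.inv) hB'))
  change (g.inv.hom.app a).hom ((g.hom.hom.app a).hom x.1) ∈ B.obj a
  rw [hg]
  exact x.2

lemma properSum_le_comap_linMap {a b : 𝒜} (f : a ⟶ b) :
    properSum k A a ≤ (properSum k A b).comap (linMap k A f) :=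
  iSup₂_le fun B hB =>
    (lmapDomain_range_le k (B.obj a).subtype (B.obj b).subtype (A.obj.map f).hom
      (fun x : B.obj a => ⟨(A.obj.map f).hom x.1, B.map_mem f x.2⟩) fun _ => rfl).trans
      (Submodule.comap_mono (le_iSup₂ (f := fun (B : AddSubfunctor A) (_ : B.IsProper) =>
        LinearMap.range (Finsupp.lmapDomain k k (B.obj b).subtype)) B hB))

lemma quotKer_le_comap_linEnd (g : Aut A) (a : 𝒜) :
    quotKer k A a ≤ (quotKer k A a).comap (linRep k A a g) := by
  have hg' : ∀ (b : 𝒜) (x : A.obj.obj b), (g.hom.hom.app b).hom ((g.inv.hom.app b).hom x) = x :=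
    fun b x => ConcreteCategory.congr_hom
      (congrArg (fun h : A ⟶ A => h.hom.app b) g.inv_hom_id) x
  intro y hy
  simp only [quotKer, Submodule.mem_comap, Submodule.mem_iInf] at hy ⊢
  intro B hB
  have hB' : (B.comap g.hom).IsNonzero := by
    obtain ⟨b, hb⟩ := hB
    refine ⟨b, fun h => hb ((AddSubgroup.eq_bot_iff_forall _).2 fun x hx => ?_)⟩
    have := (AddSubgroup.eq_bot_iff_forall _).1 h ((g.inv.hom.app b).hom x) (by
      change (g.hom.hom.app b).hom ((g.inv.hom.app b).hom x) ∈ B.obj b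
      rw [hg']
      exact hx)
    rw [← hg' b x, this, map_zero]
  exact lmapDomain_ker_le k _ (QuotientAddGroup.mk' (B.obj a)) _
    (QuotientAddGroup.map ((B.comap g.hom).obj a) (B.obj a) (g.hom.hom.app a).hom le_rfl)
    (fun x => rfl) (hy (B.comap g.hom) hB')

lemma quotKer_le_comap_linMap {a b : 𝒜} (f : a ⟶ b) :
    quotKer k A a ≤ (quotKer k A b).comap (linMap k A f) := by
  intro y hy
  simp only [quotKer, Submodule.mem_comap, Submodule.mem_iInf] at hy ⊢
  intro B hB
  exact lmapDomain_ker_le k _ (QuotientAddGroup.mk' (B.obj b)) _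
    (QuotientAddGroup.map (B.obj a) (B.obj b) (A.obj.map f).hom fun x hx => B.map_mem f hx)
    (fun x => rfl) (hy B hB)

lemma linMap_comp_linRep {a b : 𝒜} (f : a ⟶ b) (g : Aut A) :
    linMap k A f ∘ₗ linRep k A a g = linRep k A b g ∘ₗ linMap k A f := by
  ext x : 2
  have h := ConcreteCategory.congr_hom (g.hom.hom.naturality f) x
  simp only [linMap, linRep, linEnd, MonoidHom.coe_mk, OneHom.coe_mk, LinearMap.comp_apply,
    Finsupp.lsingle_apply, Finsupp.lmapDomain_apply, Finsupp.mapDomain_single]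
  exact congrArg (fun z => Finsupp.single z (1 : k)) h.symm

lemma linMap_id (a : 𝒜) : linMap k A (𝟙 a) = LinearMap.id := by
  ext x : 2
  simp [linMap]

lemma linMap_comp {a b c : 𝒜} (f : a ⟶ b) (g : b ⟶ c) :
    linMap k A (f ≫ g) = linMap k A g ∘ₗ linMap k A f := by
  ext x : 2
  simp [linMap, Finsupp.mapDomain_single]

/-- The action of `Aut(A)` on `Q_A(a)`. -/
def QlowerRep (a : 𝒜) : Representation k (Aut A) ((A.obj.obj a →₀ k) ⧸ properSum k A a) :=
  (linRep k A a).quotient (properSum k A a) fun g => properSum_le_comap_linEnd k A g a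

/-- The action of `Aut(A)` on `Q^A(a)`. -/
def QupperRep (a : 𝒜) : Representation k (Aut A) (quotKer k A a) :=
  (linRep k A a).subrepresentation (quotKer k A a) fun g => quotKer_le_comap_linEnd k A g a

/-- The map `Q_A(a) → Q_A(b)` induced by `a ⟶ b`. -/
def QlowerMap {a b : 𝒜} (f : a ⟶ b) : (QlowerRep k A a).IntertwiningMap (QlowerRep k A b) where
  toLinearMap := Submodule.mapQ _ _ (linMap k A f) (properSum_le_comap_linMap k A f)
  isIntertwining' g := Submodule.linearMap_qext _ (LinearMap.ext fun x =>
    congrArg (Submodule.mkQ _) (LinearMap.congr_fun (linMap_comp_linRep k A f g) x))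

/-- The map `Q^A(a) → Q^A(b)` induced by `a ⟶ b`. -/
def QupperMap {a b : 𝒜} (f : a ⟶ b) : (QupperRep k A a).IntertwiningMap (QupperRep k A b) where
  toLinearMap := (linMap k A f).restrict (quotKer_le_comap_linMap k A f)
  isIntertwining' g := LinearMap.ext fun x =>
    Subtype.ext (LinearMap.congr_fun (linMap_comp_linRep k A f g) x.1)

/-- The functor `Q_A = coker (⨁_{B ⊊ A} k[B] → k[A])`, with the action of `Aut(A)`. -/
def Qlower : 𝒜 ⥤ Rep.{w} k (Aut A) where
  obj a := Rep.of (QlowerRep k A a)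
  map f := Rep.ofHom (QlowerMap k A f)
  map_id a := Rep.hom_ext (Representation.IntertwiningMap.ext
    (Submodule.linearMap_qext _ (LinearMap.ext fun x =>
      congrArg (Submodule.mkQ _) (LinearMap.congr_fun (linMap_id k A a) x))))
  map_comp f g := Rep.hom_ext (Representation.IntertwiningMap.ext
    (Submodule.linearMap_qext _ (LinearMap.ext fun x =>
      congrArg (Submodule.mkQ _) (LinearMap.congr_fun (linMap_comp k A f g) x))))

/-- The functor `Q^A = ker (k[A] → ∏_{0 ≠ B ⊆ A} k[A/B])`, with the action of `Aut(A)`. -/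
def Qupper : 𝒜 ⥤ Rep.{w} k (Aut A) where
  obj a := Rep.of (X := quotKer k A a) (QupperRep k A a)
  map {a b} f := Rep.ofHom (X := quotKer k A a) (Y := quotKer k A b) (QupperMap k A f)
  map_id a := Rep.hom_ext (Representation.IntertwiningMap.ext (LinearMap.ext fun x =>
    Subtype.ext (LinearMap.congr_fun (linMap_id k A a) x.1)))
  map_comp f g := Rep.hom_ext (Representation.IntertwiningMap.ext (LinearMap.ext fun x => by
    exact Subtype.ext (LinearMap.congr_fun (linMap_comp k A f g) x.1)))

/-- The composite `Q^A(a) ↪ k[A(a)] ↠ Q_A(a)`. -/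
def QupperToQlowerMap (a : 𝒜) : (QupperRep k A a).IntertwiningMap (QlowerRep k A a) where
  toLinearMap := (properSum k A a).mkQ ∘ₗ (quotKer k A a).subtype
  isIntertwining' _ := rfl

/-- The canonical `Aut(A)`-equivariant morphism `Q^A ↪ k[A] ↠ Q_A`. -/
def QupperToQlower : Qupper k A ⟶ Qlower k A where
  app a := Rep.ofHom (X := quotKer k A a) (QupperToQlowerMap k A a)
  naturality _ _ _ := rfl

variable {k A}

/-- The functor `Q(A, M)` attached to an additive functor `A` and a `k`-linear representation `M`
of `Aut(A)`: the image of the morphism `M ⊗_{k[Aut(A)]} Q^A → M ⊗_{k[Aut(A)]} Q_A` obtained from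
`Q^A ↪ k[A] ↠ Q_A`. The tensor product over `k[Aut(A)]` is the space of coinvariants of the
tensor product over `k`, under the diagonal action of `Aut(A)`. -/
def Q (M : Rep.{w} k (Aut A)) : 𝒜 ⥤ ModuleCat.{w} k :=
  image (Functor.whiskerRight (QupperToQlower k A) ((Rep.coinvariantsTensor k (Aut A)).obj M))

end AddRepLin

end

/-! One half of the finiteness statement is formal: `B ↦ k[B]` is strictly monotone on subfunctors,
so chain conditions descend from `k[A]` to `A`. Conversely, let `A` have finite length. Being
noetherian, it is generated by a single `x ∈ A(a)`; being artinian, it has an object `c` such that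
morphisms to `c` detect nonzero elements. Each `A(b)` is a quotient of `Hom(a, b)`, hence finite.
The generators lying in `A(b)` give a basis of `Q_A(b)`, and `Aut(A)` permutes them freely.

For simple `M`, the functor `Q(A, M)` is simple (`simple_Q`). A nonzero `t` in `M ⊗ Q_A` is a sum of
terms `m_y ⊗ [y]` over generators in distinct orbits. Averaging over the group of morphisms killing
a generator `y`, whose order is invertible in `k`, produces a combination of morphisms that carries
one chosen generator to any prescribed `ξ` in `Q^A` and kills the others (`exists_separating`). So
`t` generates `m ⊗ Q^A` for some `m ≠ 0`, hence the whole image of `M ⊗ Q^A`. This image is nonzero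
because `Q^A` contains an external product of differences `[y] - [0]` (`exists_mem_quotKer_ne_zero`,
`tmk_ne_zero`).

The objects of finite length whose simple subquotients are all of the form `Q(B, M)`, with `B` a
subquotient of `A`, form a Serre class; `k[A]` lies in it by induction over subquotients of `A`.
Modulo finitely many `k[B]` with `B` proper, `k[A]` becomes `Q_A`, which embeds in `k[A(a)] ⊗ Q_A`.
Filtering the finite-dimensional representation `k[A(a)]` leaves `M ⊗ Q_A` with `M` simple. Its
quotient by `Q(A, M)` is a quotient of `k[A]/Q^A`, which embeds in a finite product of `k[A/B]` with
`B ≠ 0`. Finally `Q(B, M)` does occur: it is contained in `M ⊗ Q_B`, a quotient of `k[B]`. -/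

noncomputable section

namespace AddRepLin

/-! ### Finite length, subquotients and composition factors in abelian categories -/

section FiniteLength

variable {C : Type u} [Category.{v} C]

lemma IsFiniteLength.of_mono {X Y : C} (i : X ⟶ Y) [Mono i] (h : IsFiniteLength Y) :
    IsFiniteLength X := by
  have := h.1
  have := h.2
  exact ⟨isArtinianObject_of_mono i, isNoetherianObject_of_mono i⟩

lemma isFiniteLength_iff (X : C) :
    IsFiniteLength X ↔ WellFoundedLT (Subobject X) ∧ WellFoundedGT (Subobject X) :=
  and_congr (ObjectProperty.is_iff _ _) (ObjectProperty.is_iff _ _)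

/-- Finite length descends along strictly monotone maps of posets of subobjects. -/
lemma isFiniteLength_of_strictMono {X : C} {α : Type*} [Preorder α] [WellFoundedLT α]
    [WellFoundedGT α] (f : Subobject X → α) (hf : StrictMono f) : IsFiniteLength X :=
  (isFiniteLength_iff X).2 ⟨hf.wellFoundedLT, hf.wellFoundedGT⟩

variable [Abelian C]

lemma subobject_factors_of_epi {X Y Z : C} (P : Subobject Z) (e : X ⟶ Y) [Epi e] (f : Y ⟶ Z)
    (h : P.Factors (e ≫ f)) : P.Factors f := by
  have sq : CommSq (P.factorThru _ h) e P.arrow f := ⟨by simp⟩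
  have : StrongEpi e := strongEpi_of_epi e
  rw [← sq.fac_right]
  exact Subobject.factors_comp_arrow _

lemma subobject_pullback_factors_iff {X Y Z : C} (f : X ⟶ Y) (P : Subobject Y) (g : Z ⟶ X) :
    ((Subobject.pullback f).obj P).Factors g ↔ P.Factors (g ≫ f) := by
  constructor
  · intro h
    have := (Subobject.isPullback f P).w
    rw [← Subobject.factorThru_arrow _ g h, Category.assoc, ← this, ← Category.assoc]
    exact Subobject.factors_comp_arrow _
  · intro h
    rw [← (Subobject.isPullback f P).lift_snd (P.factorThru _ h) g (by simp)]
    exact Subobject.factors_comp_arrow _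

/-- Pulling back along an epimorphism is injective on subobjects: the pulled-back subobject still
maps onto the original one, which can therefore be recovered. -/
lemma IsFiniteLength.of_epi {X Y : C} (q : X ⟶ Y) [Epi q] (h : IsFiniteLength X) :
    IsFiniteLength Y := by
  obtain ⟨_, _⟩ := (isFiniteLength_iff X).1 h
  refine isFiniteLength_of_strictMono (Subobject.pullback q).obj
    ((Functor.monotone _).strictMono_of_injective fun P P' hP => ?_)
  have key : ∀ P P' : Subobject Y,
      (Subobject.pullback q).obj P = (Subobject.pullback q).obj P' → P ≤ P' := by
    intro P P' hP
    have hepi : Epi (Subobject.pullbackπ q P) := by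
      rw [← (Subobject.isPullback q P).isoPullback_hom_fst]
      infer_instance
    refine Subobject.le_of_factors (subobject_factors_of_epi _ (Subobject.pullbackπ q P) _ ?_)
    rw [(Subobject.isPullback q P).w, ← subobject_pullback_factors_iff, ← hP]
    exact Subobject.factors_self _
  exact (key _ _ hP).antisymm (key _ _ hP.symm)

/-- A subobject `W` of the middle term is controlled by its trace on `X₁` and its image in `X₃`:
nested subobjects with the same trace and image coincide. -/
lemma IsFiniteLength.of_shortExact {S : ShortComplex C} (hS : S.ShortExact)
    (h₁ : IsFiniteLength S.X₁) (h₃ : IsFiniteLength S.X₃) : IsFiniteLength S.X₂ := by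
  obtain ⟨_, _⟩ := (isFiniteLength_iff _).1 h₁
  obtain ⟨_, _⟩ := (isFiniteLength_iff _).1 h₃
  have := hS.mono_f
  let F : Subobject S.X₂ → Subobject S.X₁ × Subobject S.X₃ := fun W =>
    ((Subobject.pullback S.f).obj W, imageSubobject (W.arrow ≫ S.g))
  have hF : Monotone F := by
    intro W W' h
    refine ⟨(Functor.monotone (Subobject.pullback S.f)) h, ?_⟩
    change imageSubobject (W.arrow ≫ S.g) ≤ imageSubobject (W'.arrow ≫ S.g)
    rw [← Subobject.ofLE_arrow h, Category.assoc]
    exact imageSubobject_comp_le _ _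
  refine isFiniteLength_of_strictMono F fun W W' hW => lt_of_le_of_ne (hF hW.le) fun hEq => ?_
  refine hW.not_ge ?_
  obtain ⟨e₁, e₂⟩ := Prod.mk.inj hEq
  let I := imageSubobject (W.arrow ≫ S.g)
  let j := Subobject.ofLE _ _ hW.le
  have hI : I.Factors (W'.arrow ≫ S.g) := by
    change (imageSubobject (W.arrow ≫ S.g)).Factors _
    rw [e₂]
    exact (congrArg _ (imageSubobject_arrow_comp (W'.arrow ≫ S.g))).mp
      (Subobject.factors_of_factors_right _ (Subobject.factors_self _))
  let t := I.factorThru _ hI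
  have hjt : j ≫ t = factorThruImageSubobject (W.arrow ≫ S.g) := by
    rw [← cancel_mono I.arrow]
    simp [t, j, I]
  have : Epi (j ≫ t) := by rw [hjt]; infer_instance
  have : Epi t := epi_of_epi j t
  -- The kernel of `W' ⟶ I` lies in `X₁`, hence in `W` by equality of traces. So the cokernel of `j`
  -- factors through `t`; as `j ≫ t` is epi, the factorization is zero and `j` is epi.
  have hk : kernel.ι t ≫ cokernel.π j = 0 := by
    have h0 : (kernel.ι t ≫ W'.arrow) ≫ S.g = 0 := by
      rw [Category.assoc, ← I.factorThru_arrow _ hI, kernel.condition_assoc, zero_comp]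
    let l := hS.exact.lift _ h0
    have hl : l ≫ S.f = kernel.ι t ≫ W'.arrow := hS.exact.lift_f _ h0
    have hf : W.Factors (kernel.ι t ≫ W'.arrow) := by
      rw [← hl, ← subobject_pullback_factors_iff, e₁, subobject_pullback_factors_iff, hl]
      exact Subobject.factors_comp_arrow _
    have : kernel.ι t = W.factorThru _ hf ≫ j := by
      rw [← cancel_mono W'.arrow]
      simp [j]
    rw [this, Category.assoc, cokernel.condition, comp_zero]
  have hd : Abelian.epiDesc t _ hk = 0 := by
    rw [← cancel_epi (j ≫ t), Category.assoc, Abelian.comp_epiDesc]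
    simp
  have hc : cokernel.π j = 0 := by
    rw [← Abelian.comp_epiDesc t _ hk, hd, comp_zero]
  have : Epi j := Preadditive.epi_of_cokernel_zero hc
  have : IsIso j := isIso_of_mono_of_epi j
  refine Subobject.le_of_comm (inv j) ?_
  rw [IsIso.inv_comp_eq]
  exact (Subobject.ofLE_arrow hW.le).symm

end FiniteLength

section Subquotient

variable {C : Type u} [Category.{v} C]

lemma IsSubquotient.of_mono {Y X X' : C} (h : IsSubquotient Y X) (i : X ⟶ X') [Mono i] :
    IsSubquotient Y X' := by
  obtain ⟨Z, j, p, _, _⟩ := h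
  exact ⟨Z, j ≫ i, p, inferInstance, inferInstance⟩

lemma IsSubquotient.of_epi {Y Y' X : C} (h : IsSubquotient Y X) (p : Y ⟶ Y') [Epi p] :
    IsSubquotient Y' X := by
  obtain ⟨Z, j, q, _, _⟩ := h
  exact ⟨Z, j, q ≫ p, inferInstance, inferInstance⟩

variable [Abelian C]

lemma IsSubquotient.of_epi_right {Y X X' : C} (h : IsSubquotient Y X) (p : X' ⟶ X) [Epi p] :
    IsSubquotient Y X' := by
  obtain ⟨Z, j, q, _, _⟩ := h
  exact ⟨pullback p j, pullback.fst p j, pullback.snd p j ≫ q, inferInstance, inferInstance⟩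

/-- Let `T` be a quotient of `W ⊆ X₂`. Either `W ∩ X₁` already maps onto the simple object `T`, or
it maps to zero and `T` is a quotient of the image of `W` in `X₃`. -/
lemma IsSubquotient.of_shortExact {S : ShortComplex C} (hS : S.ShortExact) {T : C} [Simple T]
    (h : IsSubquotient T S.X₂) : IsSubquotient T S.X₁ ∨ IsSubquotient T S.X₃ := by
  obtain ⟨W, i, p, _, _⟩ := h
  have := hS.mono_f
  by_cases h0 : pullback.fst i S.f ≫ p = 0
  · right
    let t := factorThruImage (i ≫ S.g)
    have hk : kernel.ι t ≫ p = 0 := by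
      have h1 : (kernel.ι t ≫ i) ≫ S.g = 0 := by
        have := kernel.condition_assoc t (image.ι (i ≫ S.g))
        rwa [image.fac, zero_comp, ← Category.assoc] at this
      have : kernel.ι t = pullback.lift (kernel.ι t) (hS.exact.lift _ h1)
          (hS.exact.lift_f _ h1).symm ≫ pullback.fst i S.f :=
        (pullback.lift_fst _ _ _).symm
      rw [this, Category.assoc, h0, comp_zero]
    have : Epi (Abelian.epiDesc t p hk) := by
      have : Epi (t ≫ Abelian.epiDesc t p hk) := by rw [Abelian.comp_epiDesc]; infer_instance
      exact epi_of_epi t _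
    exact ⟨_, image.ι (i ≫ S.g), Abelian.epiDesc t p hk, inferInstance, this⟩
  · left
    exact ⟨_, pullback.snd i S.f, pullback.fst i S.f ≫ p, inferInstance,
      epi_of_nonzero_to_simple h0⟩

end Subquotient

section CompositionFactors

variable {C : Type u} [Category.{v} C] [Abelian C]

/-- The preimage in `b` of a subobject of `b/a` lies between `a` and `b`, so it is one of the two.
-/
lemma simple_cokernel_of_covBy {X : C} {a b : Subobject X} (h : a ⋖ b) :
    Simple (cokernel (Subobject.ofLE a b h.le)) := by
  have hN : cokernel.π (Subobject.ofLE a b h.le) ≠ 0 := fun h0 => by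
    have : Epi (Subobject.ofLE a b h.le) := Preadditive.epi_of_cokernel_zero h0
    have : IsIso (Subobject.ofLE a b h.le) := isIso_of_mono_of_epi _
    refine h.lt.not_ge (Subobject.le_of_comm (inv (Subobject.ofLE a b h.le)) ?_)
    rw [IsIso.inv_comp_eq]
    exact (Subobject.ofLE_arrow h.le).symm
  refine ⟨fun {T} j _ => ⟨fun hj h0 => hN ?_, fun hj => ?_⟩⟩
  · rw [← cancel_mono (inv j), ← cancel_mono j]
    simp [h0]
  · let π := cokernel.π (Subobject.ofLE a b h.le)
    let c := Subobject.mk (pullback.fst π j ≫ b.arrow)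
    have hac : a ≤ c := by
      refine Subobject.le_mk_of_comm
        (pullback.lift (Subobject.ofLE a b h.le) 0 (by simp [π])) ?_
      rw [pullback.lift_fst_assoc, Subobject.ofLE_arrow]
    have hcb : c ≤ b := Subobject.mk_le_of_comm (pullback.fst π j) rfl
    rcases h.eq_or_eq hac hcb with hc | hc
    · exfalso
      apply hj
      have hf : a.Factors (pullback.fst π j ≫ b.arrow) :=
        Subobject.factors_of_le _ hc.le (Subobject.mk_factors_self _)
      have : pullback.fst π j = a.factorThru _ hf ≫ Subobject.ofLE a b h.le := by
        rw [← cancel_mono b.arrow]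
        simp
      rw [← cancel_epi (pullback.snd π j), ← pullback.condition, this]
      simp [π]
    · have hf : (Subobject.mk (pullback.fst π j ≫ b.arrow)).Factors b.arrow :=
        Subobject.factors_of_le _ hc.ge (Subobject.factors_self b)
      obtain ⟨s, hs⟩ : ∃ s : (b : C) ⟶ pullback π j, s ≫ pullback.fst π j ≫ b.arrow = b.arrow :=
        (Subobject.mk_factors_iff _ _).1 hf
      have hs' : s ≫ pullback.fst π j = 𝟙 _ := by
        rw [← cancel_mono b.arrow]
        rw [Category.assoc, hs, Category.id_comp]
      have : Epi j := by
        have : π = (s ≫ pullback.snd π j) ≫ j := by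
          rw [Category.assoc, ← pullback.condition, ← Category.assoc, hs', Category.id_comp]
        have : Epi ((s ≫ pullback.snd π j) ≫ j) := by rw [← this]; infer_instance
        exact epi_of_epi (s ≫ pullback.snd π j) j
      exact isIso_of_mono_of_epi j

/-- The relation of having a simple quotient, between subobjects. -/
def simpleStep (X : C) : SetRel (Subobject X) (Subobject X) :=
  {p | ∃ h : p.1 ≤ p.2, Simple (cokernel (Subobject.ofLE p.1 p.2 h))}

lemma exists_simpleStep_series {X : C} (hX : IsFiniteLength X) {a b : Subobject X} (h : a ≤ b) :
    ∃ s : RelSeries (simpleStep X), s.head = a ∧ s.last = b := by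
  obtain ⟨_, _⟩ := (isFiniteLength_iff _).1 hX
  obtain ⟨f, h0, n, hn, hf⟩ := exists_covBy_seq_of_wellFoundedLT_wellFoundedGT_of_le h
  refine ⟨⟨n, fun i => f i, fun i => ?_⟩, h0, hn⟩
  have := hf i i.2
  exact ⟨this.le, simple_cokernel_of_covBy this⟩

/-- A series of simple steps from the bottom to the top is a composition series. -/
def CompSeries.ofRelSeries {X : C} (s : RelSeries (simpleStep X)) (h₀ : s.head = ⊥)
    (h₁ : s.last = ⊤) : CompSeries X where
  length := s.length
  sub := s.toFun
  sub_zero := h₀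
  sub_last := h₁
  le_succ i := (s.step i).1
  simple i := (s.step i).2

/-- Write `S ≅ Z/Y` and refine the chain `⊥ ≤ Y ≤ Z ≤ ⊤` on both sides of the simple step from `Y`
to `Z`. -/
lemma IsSubquotient.isCompositionFactor {S X : C} [Simple S] (hX : IsFiniteLength X)
    (h : IsSubquotient S X) : IsCompositionFactor S X := by
  obtain ⟨W, i, p, _, _⟩ := h
  let Z := Subobject.mk i
  let Y := Subobject.mk (kernel.ι p ≫ i)
  have hYZ : Y ≤ Z := Subobject.mk_le_mk_of_comm (kernel.ι p) rfl
  have e : cokernel (Subobject.ofLE Y Z hYZ) ≅ S :=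
    cokernel.mapIso _ (kernel.ι p) (Subobject.underlyingIso _) (Subobject.underlyingIso _) (by
      rw [← cancel_mono i]
      simp [Y, Z]) ≪≫ (IsColimit.coconePointUniqueUpToIso (colimit.isColimit _)
        (Abelian.epiIsCokernelOfKernel _ (limit.isLimit (parallelPair p 0))))
  obtain ⟨s, hs₀, hs₁⟩ := exists_simpleStep_series hX (bot_le : ⊥ ≤ Y)
  obtain ⟨t, ht₀, ht₁⟩ := exists_simpleStep_series hX (le_top : Z ≤ ⊤)
  have hc : (s.last, t.head) ∈ simpleStep X := by
    rw [hs₁, ht₀]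
    exact ⟨hYZ, Simple.of_iso e⟩
  let r := s.append t hc
  -- The step from `Y` to `Z` joins the last term of `s` to the first term of `t`, so it has index
  -- `s.length`.
  refine ⟨CompSeries.ofRelSeries r (by simp [r, hs₀]) (by simp [r, ht₁]),
    ⟨s.length, by simp [CompSeries.ofRelSeries, r]⟩, ?_⟩
  have aux : ∀ (a b : Subobject X) (h : a ≤ b), a = Y → b = Z →
      Nonempty (S ≅ cokernel (Subobject.ofLE a b h)) := by
    rintro _ _ _ rfl rfl
    exact ⟨e.symm⟩
  refine aux _ _ _ ?_ ?_
  · rw [← hs₁]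
    exact Fin.append_left s t (Fin.last _)
  · rw [← ht₀]
    exact Fin.append_right s t 0

lemma IsCompositionFactor.simple_and_isSubquotient {S X : C} (h : IsCompositionFactor S X) :
    Simple S ∧ IsSubquotient S X := by
  obtain ⟨s, i, ⟨e⟩⟩ := h
  have : Simple (s.factor i) := s.simple i
  have : Epi (cokernel.π (Subobject.ofLE _ _ (s.le_succ i)) ≫ e.inv) :=
    epi_comp' inferInstance (IsIso.epi_of_iso e.inv)
  exact ⟨Simple.of_iso e, ((s.sub i.succ : C)), (s.sub i.succ).arrow, _, inferInstance, this⟩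

end CompositionFactors

/-! ### Serre classes and dévissage along finite families -/

section SerreClass

variable {C : Type u} [Category.{v} C] [Abelian C]

/-- The objects of finite length all of whose simple subquotients satisfy `R`. -/
def finiteLengthWithFactors (R : C → Prop) : ObjectProperty C := fun X =>
  IsFiniteLength X ∧ ∀ S : C, Simple S → IsSubquotient S X → R S

/-- Finite length and the shape of the simple subquotients are carried together, so that a single
dévissage yields both parts of the theorem. -/
instance (R : C → Prop) : (finiteLengthWithFactors R).IsSerreClass where
  exists_zero := by
    open ZeroObject in
    refine ⟨(0 : C), isZero_zero C, ⟨isArtinianObject_of_isZero (isZero_zero C),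
      isNoetherianObject_of_isZero (isZero_zero C)⟩, fun S _ hS => ?_⟩
    obtain ⟨Z, i, p, _, _⟩ := hS
    exact (Simple.not_isZero S (((isZero_zero C).of_mono i).of_epi p)).elim
  prop_of_mono f _ h := ⟨h.1.of_mono f, fun S hS hSX => h.2 S hS (hSX.of_mono f)⟩
  prop_of_epi f _ h := ⟨h.1.of_epi f, fun S hS hSX => h.2 S hS (hSX.of_epi_right f)⟩
  prop_X₂_of_shortExact hS h₁ h₃ := ⟨.of_shortExact hS h₁.1 h₃.1, fun T hT hTX =>
    (IsSubquotient.of_shortExact hS hTX).elim (h₁.2 T hT) (h₃.2 T hT)⟩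

lemma finiteLengthWithFactors_of_simple {R : C → Prop} {S : C} [Simple S]
    (hR : ∀ T : C, Nonempty (T ≅ S) → R T) : finiteLengthWithFactors R S := by
  have := (simple_iff_subobject_isSimpleOrder S).1 inferInstance
  have : Finite (Subobject S) := by
    classical exact Finite.of_equiv Bool IsSimpleOrder.equivBool.symm
  refine ⟨(isFiniteLength_iff S).2 ⟨Finite.to_wellFoundedLT, Finite.to_wellFoundedGT⟩, fun T _ hT => hR T ?_⟩
  obtain ⟨Z, i, p, _, _⟩ := hT
  have hi : i ≠ 0 := by
    rintro rfl
    exact Simple.not_isZero T ((IsZero.of_mono_zero Z S).of_epi p)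
  have := isIso_of_mono_of_nonzero hi
  have hp : inv i ≫ p ≠ 0 := fun h0 => by
    have : Epi (inv i ≫ p) := inferInstance
    rw [h0] at this
    exact Simple.not_isZero T (IsZero.of_epi_zero S T)
  have := isIso_of_epi_of_nonzero hp
  exact ⟨(asIso (inv i ≫ p)).symm⟩

variable (P : ObjectProperty C) [P.IsSerreClass]

/-- `q` factors through the image of `u`, so `W` is a quotient of a subobject of `Y`. -/
lemma prop_of_kernel_comp_eq_zero {X Y W : C} (u : X ⟶ Y) (q : X ⟶ W) [Epi q]
    (h : kernel.ι u ≫ q = 0) (hY : P Y) : P W := by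
  have hk : kernel.ι (factorThruImage u) ≫ q = 0 := by
    have : kernel.ι (factorThruImage u) =
        kernel.lift u (kernel.ι (factorThruImage u)) (by
          have := kernel.condition_assoc (factorThruImage u) (image.ι u)
          rwa [image.fac, zero_comp] at this) ≫ kernel.ι u := by simp
    rw [this, Category.assoc, h, comp_zero]
  have : Epi (Abelian.epiDesc (factorThruImage u) q hk) := by
    have : Epi (factorThruImage u ≫ Abelian.epiDesc (factorThruImage u) q hk) := by
      rw [Abelian.comp_epiDesc]; infer_instance
    exact epi_of_epi (factorThruImage u) _
  exact P.prop_of_epi (Abelian.epiDesc (factorThruImage u) q hk)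
    (P.prop_of_mono (image.ι u) hY)

/-- If `Zᵢ ⟶ X` is a finite family of morphisms, then `X` belongs to a Serre class as soon as the
`Zᵢ` and the quotients of `X` killing all `Zᵢ` do. -/
lemma prop_of_family_from {ι : Type*} [Finite ι] {Z : ι → C} (hZ : ∀ i, P (Z i)) {X : C}
    (f : ∀ i, Z i ⟶ X) (h : ∀ (T : C) (g : X ⟶ T), Epi g → (∀ i, f i ≫ g = 0) → P T) : P X := by
  classical
  have key : ∀ (s : Finset ι) (X : C) (f : ∀ i, Z i ⟶ X),
      (∀ (T : C) (g : X ⟶ T), Epi g → (∀ i ∈ s, f i ≫ g = 0) → P T) → P X := by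
    intro s
    induction s using Finset.induction_on with
    | empty => exact fun X f h => h X (𝟙 X) inferInstance (by simp)
    | insert a s _ ih =>
      intro X f h
      refine P.prop_X₂_of_exact (S := ShortComplex.mk (f a) (cokernel.π (f a))
        (cokernel.condition _)) (ShortComplex.exact_cokernel _) (hZ a)
        (ih _ (fun i => f i ≫ cokernel.π (f a)) fun T g _ hg => ?_)
      refine h T (cokernel.π (f a) ≫ g) inferInstance fun i hi => ?_
      rcases Finset.mem_insert.1 hi with rfl | hi
      · simp
      · simpa using hg i hi
  have := Fintype.ofFinite ι
  exact key Finset.univ X f fun T g hg hf => h T g hg fun i => hf i (Finset.mem_univ i)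

/-- If `X ⟶ Zᵢ` is a finite family of morphisms to objects of a Serre class, then every quotient of
`X` which kills the intersection of their kernels belongs to the Serre class. -/
lemma prop_of_family_to {ι : Type*} [Finite ι] {Z : ι → C} (hZ : ∀ i, P (Z i)) {X W : C}
    (f : ∀ i, X ⟶ Z i) (q : X ⟶ W) [Epi q]
    (h : ∀ (K : C) (j : K ⟶ X), (∀ i, j ≫ f i = 0) → j ≫ q = 0) : P W := by
  classical
  have key : ∀ (s : Finset ι) (X W : C) (f : ∀ i, X ⟶ Z i) (q : X ⟶ W), Epi q →
      (∀ (K : C) (j : K ⟶ X), (∀ i ∈ s, j ≫ f i = 0) → j ≫ q = 0) → P W := by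
    intro s
    induction s using Finset.induction_on with
    | empty =>
      intro X W f q _ h
      have hq : q = 0 := by simpa using h X (𝟙 X) (by simp)
      subst hq
      exact P.prop_of_isZero (IsZero.of_epi_zero X W)
    | insert a s _ ih =>
      intro X W f q _ h
      -- The image in `W` of the kernel of `f a` is handled by the remaining morphisms; what is left
      -- of `W` is a quotient of the image of `f a`.
      let g := kernel.ι (f a) ≫ q
      have h₁ : P (image g) := by
        refine ih (kernel (f a)) _ (fun i => kernel.ι (f a) ≫ f i) (factorThruImage g)
          inferInstance fun K j hj => ?_
        rw [← cancel_mono (image.ι g), Category.assoc, image.fac, zero_comp, ← Category.assoc]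
        refine h K _ fun i hi => ?_
        rcases Finset.mem_insert.1 hi with rfl | hi
        · simp
        · simpa using hj i hi
      refine P.prop_X₂_of_exact (S := ShortComplex.mk (image.ι g) (cokernel.π (image.ι g))
        (cokernel.condition _)) (ShortComplex.exact_cokernel _) h₁
        (prop_of_kernel_comp_eq_zero P (f a) (q ≫ cokernel.π (image.ι g)) ?_ (hZ a))
      change kernel.ι (f a) ≫ q ≫ cokernel.π (image.ι g) = 0
      have : kernel.ι (f a) ≫ q = factorThruImage g ≫ image.ι g := (image.fac g).symm
      rw [← Category.assoc, this, Category.assoc, cokernel.condition, comp_zero]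
  have := Fintype.ofFinite ι
  exact key Finset.univ X W f q inferInstance fun K j hj =>
    h K j fun i => hj i (Finset.mem_univ i)

end SerreClass

end AddRepLin

end

noncomputable section

namespace AddRepLin

variable {𝒜 : Type u} [Category.{v} 𝒜] [Preadditive 𝒜]

/-! ### Additive functors, their subfunctors and quotients -/

section Hom

variable {A B : 𝒜 ⥤+ AddCommGrpCat.{w}}

/-- A morphism of additive functors, from a natural family of additive maps. -/
def addHomMk (φ : ∀ a, A.obj.obj a →+ B.obj.obj a)
    (h : ∀ {a b : 𝒜} (f : a ⟶ b) (x : A.obj.obj a),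
      φ b ((A.obj.map f).hom x) = (B.obj.map f).hom (φ a x)) : A ⟶ B :=
  ObjectProperty.homMk
    { app a := AddCommGrpCat.ofHom (φ a)
      naturality a b f := by
        ext x
        exact h f x }

lemma addHom_ext {f g : A ⟶ B} (h : ∀ a x, (f.hom.app a).hom x = (g.hom.app a).hom x) : f = g := by
  apply ObjectProperty.hom_ext
  ext a x
  exact h a x

lemma addHom_congr {f g : A ⟶ B} (h : f = g) (a : 𝒜) (x : A.obj.obj a) :
    (f.hom.app a).hom x = (g.hom.app a).hom x := by rw [h]

lemma addHom_naturality (φ : A ⟶ B) {a b : 𝒜} (f : a ⟶ b) (x : A.obj.obj a) :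
    (φ.hom.app b).hom ((A.obj.map f).hom x) = (B.obj.map f).hom ((φ.hom.app a).hom x) :=
  ConcreteCategory.congr_hom (φ.hom.naturality f) x

lemma addHom_mono_of_injective (φ : A ⟶ B)
    (h : ∀ a, Function.Injective (φ.hom.app a).hom) : Mono φ :=
  ⟨fun _ _ hfg => addHom_ext fun a x => h a (addHom_congr hfg a x)⟩

lemma addHom_epi_of_surjective (φ : A ⟶ B)
    (h : ∀ a, Function.Surjective (φ.hom.app a).hom) : Epi φ :=
  ⟨fun _ _ hfg => addHom_ext fun a x => by
    obtain ⟨y, rfl⟩ := h a x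
    exact addHom_congr hfg a y⟩

lemma map_comp_apply {a b c : 𝒜} (f : a ⟶ b) (g : b ⟶ c) (x : A.obj.obj a) :
    (A.obj.map (f ≫ g)).hom x = (A.obj.map g).hom ((A.obj.map f).hom x) := by
  simp

lemma map_id_apply (a : 𝒜) (x : A.obj.obj a) : (A.obj.map (𝟙 a)).hom x = x := by
  simp

lemma map_add_apply {a b : 𝒜} (f g : a ⟶ b) (x : A.obj.obj a) :
    (A.obj.map (f + g)).hom x = (A.obj.map f).hom x + (A.obj.map g).hom x := by
  simp [A.obj.map_add]

end Hom

namespace AddSubfunctor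

variable {A : 𝒜 ⥤+ AddCommGrpCat.{w}}

lemma obj_injective : Function.Injective (obj : AddSubfunctor A → _) := by
  rintro ⟨_, _⟩ ⟨_, _⟩ h
  simpa using h

instance : PartialOrder (AddSubfunctor A) := PartialOrder.lift obj obj_injective

instance : OrderBot (AddSubfunctor A) where
  bot := ⟨fun _ => ⊥, by simp⟩
  bot_le _ _ := bot_le

instance : OrderTop (AddSubfunctor A) where
  top := ⟨fun _ => ⊤, by simp⟩
  le_top _ _ := le_top

@[simp] lemma bot_obj (a : 𝒜) : (⊥ : AddSubfunctor A).obj a = ⊥ := rfl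

@[simp] lemma top_obj (a : 𝒜) : (⊤ : AddSubfunctor A).obj a = ⊤ := rfl

lemma isProper_iff {B : AddSubfunctor A} : B.IsProper ↔ B < ⊤ := by
  rw [lt_top_iff_ne_top, IsProper, Ne, ← obj_injective.eq_iff, funext_iff, not_forall]
  rfl

lemma isNonzero_iff {B : AddSubfunctor A} : B.IsNonzero ↔ ⊥ < B := by
  rw [bot_lt_iff_ne_bot, IsNonzero, Ne, ← obj_injective.eq_iff, funext_iff, not_forall]
  rfl

/-- A subfunctor, as an additive functor. -/
def toFunctor (B : AddSubfunctor A) : 𝒜 ⥤+ AddCommGrpCat.{w} where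
  obj :=
    { obj a := AddCommGrpCat.of (B.obj a)
      map {a b} f := AddCommGrpCat.ofHom
        (((A.obj.map f).hom.comp (B.obj a).subtype).codRestrict (B.obj b)
          fun x => B.map_mem f x.2)
      map_id a := AddCommGrpCat.hom_ext (AddMonoidHom.ext fun x =>
        Subtype.ext (map_id_apply a x.1))
      map_comp f g := AddCommGrpCat.hom_ext (AddMonoidHom.ext fun x =>
        Subtype.ext (map_comp_apply f g x.1)) }
  property := ⟨fun {_ _ f g} => AddCommGrpCat.hom_ext (AddMonoidHom.ext fun x =>
    Subtype.ext (map_add_apply f g x.1))⟩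

/-- The inclusion of a subfunctor. -/
def ι (B : AddSubfunctor A) : B.toFunctor ⟶ A :=
  addHomMk (fun a => (B.obj a).subtype) fun _ _ => rfl

instance (B : AddSubfunctor A) : Mono B.ι :=
  addHom_mono_of_injective _ fun _ => Subtype.val_injective

/-- The quotient of an additive functor by a subfunctor. -/
def quot (B : AddSubfunctor A) : 𝒜 ⥤+ AddCommGrpCat.{w} where
  obj :=
    { obj a := AddCommGrpCat.of (A.obj.obj a ⧸ B.obj a)
      map {a b} f := AddCommGrpCat.ofHom
        (QuotientAddGroup.map (B.obj a) (B.obj b) (A.obj.map f).hom fun _ hx => B.map_mem f hx)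
      map_id a := AddCommGrpCat.hom_ext (QuotientAddGroup.addMonoidHom_ext _
        (AddMonoidHom.ext fun x => congrArg QuotientAddGroup.mk (map_id_apply a x)))
      map_comp f g := AddCommGrpCat.hom_ext (QuotientAddGroup.addMonoidHom_ext _
        (AddMonoidHom.ext fun x => congrArg QuotientAddGroup.mk (map_comp_apply f g x))) }
  property := ⟨fun {_ _ f g} => AddCommGrpCat.hom_ext (QuotientAddGroup.addMonoidHom_ext _
    (AddMonoidHom.ext fun x => congrArg QuotientAddGroup.mk (map_add_apply f g x)))⟩

/-- The projection to the quotient by a subfunctor. -/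
def π (B : AddSubfunctor A) : A ⟶ B.quot :=
  addHomMk (fun a => QuotientAddGroup.mk' (B.obj a)) fun _ _ => rfl

lemma π_surjective (B : AddSubfunctor A) (a : 𝒜) : Function.Surjective (B.π.hom.app a).hom :=
  QuotientAddGroup.mk'_surjective _

/-- The image of a morphism of additive functors. -/
def range {Z : 𝒜 ⥤+ AddCommGrpCat.{w}} (φ : Z ⟶ A) : AddSubfunctor A where
  obj a := (φ.hom.app a).hom.range
  map_mem {a b} f {x} hx := by
    obtain ⟨y, rfl⟩ := hx
    exact ⟨(Z.obj.map f).hom y, addHom_naturality φ f y⟩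

/-- The kernel of a morphism of additive functors. -/
def ker {Z : 𝒜 ⥤+ AddCommGrpCat.{w}} (φ : A ⟶ Z) : AddSubfunctor A where
  obj a := (φ.hom.app a).hom.ker
  map_mem {a b} f {x} hx := by
    rw [AddMonoidHom.mem_ker] at hx ⊢
    rw [addHom_naturality, hx, map_zero]

lemma mem_range {Z : 𝒜 ⥤+ AddCommGrpCat.{w}} {φ : Z ⟶ A} {a : 𝒜} {x : A.obj.obj a} :
    x ∈ (range φ).obj a ↔ ∃ y, (φ.hom.app a).hom y = x := Iff.rfl

end AddSubfunctor

section MonoEpi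

variable {A B : 𝒜 ⥤+ AddCommGrpCat.{w}}

lemma addHom_injective_of_mono (φ : A ⟶ B) [Mono φ] (a : 𝒜) :
    Function.Injective (φ.hom.app a).hom := by
  have h : (AddSubfunctor.ker φ).ι = addHomMk (fun a => 0) (by simp) := by
    rw [← cancel_mono φ]
    refine addHom_ext fun b x => ?_
    exact (AddMonoidHom.mem_ker.1 x.2).trans (map_zero (φ.hom.app b).hom).symm
  refine (injective_iff_map_eq_zero _).2 fun x hx => ?_
  exact addHom_congr h a (⟨x, hx⟩ : (AddSubfunctor.ker φ).obj a)

lemma addHom_surjective_of_epi (φ : A ⟶ B) [Epi φ] (a : 𝒜) :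
    Function.Surjective (φ.hom.app a).hom := by
  have h : (AddSubfunctor.range φ).π = addHomMk (fun a => 0) (by simp) := by
    rw [← cancel_epi φ]
    refine addHom_ext fun b x => ?_
    exact (QuotientAddGroup.eq_zero_iff _).2 ⟨x, rfl⟩
  intro x
  exact (QuotientAddGroup.eq_zero_iff _).1
    (addHom_congr h a x)

/-- Pointwise preimages under an injective `φ` are unique, so any choice of them is additive and
natural. -/
lemma exists_addHom_factor {Z : 𝒜 ⥤+ AddCommGrpCat.{w}} (φ : A ⟶ B) [Mono φ] (ψ : Z ⟶ B)
    (h : AddSubfunctor.range ψ ≤ AddSubfunctor.range φ) : ∃ l : Z ⟶ A, l ≫ φ = ψ := by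
  have hinj := addHom_injective_of_mono φ
  choose l hl using fun (a : 𝒜) (z : Z.obj.obj a) => AddSubfunctor.mem_range.1 (h a ⟨z, rfl⟩)
  refine ⟨addHomMk (fun a => AddMonoidHom.mk' (l a) fun x y => hinj a ?_) fun {a b} f x =>
    hinj b ?_, addHom_ext hl⟩
  · rw [map_add, hl, hl, hl, map_add]
  · simp only [AddMonoidHom.mk'_apply]
    rw [hl, addHom_naturality, addHom_naturality, hl]

end MonoEpi

namespace AddSubfunctor

variable {A : 𝒜 ⥤+ AddCommGrpCat.{w}}

lemma range_ι (B : AddSubfunctor A) : range B.ι = B :=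
  obj_injective (funext fun a => (B.obj a).range_subtype)

lemma mk_ι_le_iff {B B' : AddSubfunctor A} :
    Subobject.mk B.ι ≤ Subobject.mk B'.ι ↔ B ≤ B' := by
  constructor
  · intro h a x hx
    have := addHom_congr (Subobject.ofMkLEMk_comp h) a (⟨x, hx⟩ : B.obj a)
    change _ = x at this
    rw [← this]
    exact Subtype.prop (p := fun x => x ∈ B'.obj a) _
  · intro h
    obtain ⟨l, hl⟩ := exists_addHom_factor B'.ι B.ι (by rwa [range_ι, range_ι])
    exact Subobject.mk_le_mk_of_comm l hl

lemma range_arrow_strictMono :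
    StrictMono fun P : Subobject A => range P.arrow := by
  intro P P' h
  refine lt_of_le_not_ge ?_ fun h' => h.not_ge ?_
  · rintro a _ ⟨x, rfl⟩
    exact ⟨((Subobject.ofLE P P' h.le).hom.app a).hom x,
      addHom_congr (Subobject.ofLE_arrow h.le) a x⟩
  · obtain ⟨l, hl⟩ := exists_addHom_factor P.arrow P'.arrow h'
    exact Subobject.le_of_comm l hl

lemma isFiniteLength_iff : IsFiniteLength A ↔
    WellFoundedLT (AddSubfunctor A) ∧ WellFoundedGT (AddSubfunctor A) := by
  constructor
  · intro h
    obtain ⟨_, _⟩ := (AddRepLin.isFiniteLength_iff A).1 h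
    have : StrictMono fun B : AddSubfunctor A => Subobject.mk B.ι :=
      strictMono_of_le_iff_le fun _ _ => mk_ι_le_iff.symm
    exact ⟨this.wellFoundedLT, this.wellFoundedGT⟩
  · rintro ⟨_, _⟩
    exact isFiniteLength_of_strictMono _ range_arrow_strictMono

section Presentation

variable {B : 𝒜 ⥤+ AddCommGrpCat.{w}} (Z : AddSubfunctor A) (p : Z.toFunctor ⟶ B)

/-- The inverse image in `A` of a subfunctor of a subquotient `B` of `A`. -/
def lift (W : AddSubfunctor B) : AddSubfunctor A where
  obj a := ((W.obj a).comap (p.hom.app a).hom).map (Z.obj a).subtype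
  map_mem {a b} f {x} hx := by
    obtain ⟨z, hz, rfl⟩ := hx
    refine ⟨(Z.toFunctor.obj.map f).hom z, ?_, rfl⟩
    exact (congrArg (· ∈ W.obj b) (addHom_naturality p f z)).mpr
      (W.map_mem f (AddSubgroup.mem_comap.1 hz))

variable {Z p}

lemma mem_lift {W : AddSubfunctor B} {a : 𝒜} {x : A.obj.obj a} :
    x ∈ (lift Z p W).obj a ↔ ∃ h : x ∈ Z.obj a,
      (p.hom.app a).hom (⟨x, h⟩ : Z.obj a) ∈ W.obj a := by
  constructor
  · rintro ⟨z, hz, rfl⟩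
    exact ⟨z.2, hz⟩
  · rintro ⟨h, hx⟩
    exact ⟨⟨x, h⟩, hx, rfl⟩

lemma lift_top : lift Z p ⊤ = Z :=
  obj_injective (funext fun a => AddSubgroup.ext fun x => by simp [mem_lift])

lemma lift_strictMono (hp : ∀ a, Function.Surjective (p.hom.app a).hom) :
    StrictMono (lift Z p) := by
  refine strictMono_of_le_iff_le fun W W' => ⟨fun h a x hx => ?_, fun h a y hy => ?_⟩
  · obtain ⟨hx, hx'⟩ := mem_lift.1 hx
    exact mem_lift.2 ⟨hx, h a hx'⟩
  · obtain ⟨⟨z, hz⟩, rfl⟩ := hp a y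
    exact (mem_lift.1 (h a (mem_lift.2 ⟨hz, hy⟩))).2

end Presentation

/-- Induction along proper subfunctors and proper quotients, for an additive functor of finite
length. -/
lemma subquotient_induction [WellFoundedLT (AddSubfunctor A)] [WellFoundedGT (AddSubfunctor A)]
    (P : (𝒜 ⥤+ AddCommGrpCat.{w}) → Prop)
    (h : ∀ B, IsSubquotient B A → IsFiniteLength B →
      (∀ W : AddSubfunctor B, W.IsProper → P W.toFunctor) →
      (∀ W : AddSubfunctor B, W.IsNonzero → P W.quot) → P B) : P A := by
  -- A subquotient is presented as `Z/Z₀`, and the induction is on the pair `(Z₀, Z)` with the order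
  -- reversed on `Z₀`. A proper subfunctor shrinks `Z` and keeps `Z₀`; a proper quotient enlarges
  -- `Z₀` and keeps `Z`.
  have key : ∀ (s : (AddSubfunctor A)ᵒᵈ × AddSubfunctor A) (B : 𝒜 ⥤+ AddCommGrpCat.{w})
      (Z : AddSubfunctor A) (p : Z.toFunctor ⟶ B),
      (∀ a, Function.Surjective (p.hom.app a).hom) →
      s = (OrderDual.toDual (lift Z p ⊥), Z) → P B := by
    intro s
    induction s using WellFoundedLT.induction with
    | ind s ih =>
      rintro B Z p hp rfl
      have hmono := lift_strictMono hp
      have hB : IsFiniteLength B := isFiniteLength_iff.2 ⟨hmono.wellFoundedLT, hmono.wellFoundedGT⟩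
      have := addHom_epi_of_surjective p hp
      refine h B ⟨_, Z.ι, p, inferInstance, inferInstance⟩ hB (fun W hW => ?_) fun W hW => ?_
      · let p' : (lift Z p W).toFunctor ⟶ W.toFunctor :=
          addHomMk (fun a => ((p.hom.app a).hom.comp
              (AddSubgroup.inclusion fun x hx => (mem_lift.1 hx).1)).codRestrict (W.obj a)
                fun x => (mem_lift.1 x.2).2)
            fun f x => Subtype.ext
              (addHom_naturality p f (⟨x.1, (mem_lift.1 x.2).1⟩ : Z.obj _))
        have hp' : ∀ a, Function.Surjective (p'.hom.app a).hom := by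
          rintro a ⟨w, hw⟩
          obtain ⟨⟨z, hz⟩, rfl⟩ := hp a w
          exact ⟨⟨z, mem_lift.2 ⟨hz, hw⟩⟩, rfl⟩
        refine ih _ ?_ _ _ p' hp' rfl
        have hlt : lift Z p W < Z := by
          have := hmono (isProper_iff.1 hW)
          rwa [lift_top] at this
        have heq : lift _ p' ⊥ = lift Z p ⊥ := by
          refine obj_injective (funext fun a => AddSubgroup.ext fun x => ?_)
          simp only [mem_lift, bot_obj, AddSubgroup.mem_bot]
          constructor
          · rintro ⟨⟨hx, hx'⟩, h0⟩
            exact ⟨hx, congrArg Subtype.val h0⟩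
          · rintro ⟨hx, h0⟩
            exact ⟨⟨hx, by rw [h0]; exact zero_mem _⟩, Subtype.ext h0⟩
        rw [heq]
        exact Prod.mk_lt_mk_iff_right.2 hlt
      · have hp' : ∀ a, Function.Surjective ((p ≫ W.π).hom.app a).hom := fun a =>
          (W.π_surjective a).comp (hp a)
        refine ih _ ?_ _ Z (p ≫ W.π) hp' rfl
        have heq : lift Z (p ≫ W.π) ⊥ = lift Z p W := by
          refine obj_injective (funext fun a => AddSubgroup.ext fun x => ?_)
          simp only [mem_lift, bot_obj, AddSubgroup.mem_bot]
          exact exists_congr fun hx => QuotientAddGroup.eq_zero_iff _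
        rw [heq]
        exact Prod.mk_lt_mk_iff_left.2 (hmono (isNonzero_iff.1 hW))
  exact key _ A ⊤ (⊤ : AddSubfunctor A).ι (fun a x => ⟨⟨x, trivial⟩, rfl⟩) rfl

end AddSubfunctor

/-! ### Generators and cogenerating objects -/

section Generators

variable {A : 𝒜 ⥤+ AddCommGrpCat.{w}}

/-- The morphism from a representable functor given by an element of `A(a)`. -/
def act {a : 𝒜} (x : A.obj.obj a) (b : 𝒜) : (a ⟶ b) →+ A.obj.obj b :=
  AddMonoidHom.mk' (fun f => (A.obj.map f).hom x) fun f g => by simp [A.obj.map_add]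

@[simp]
lemma act_apply {a : 𝒜} (x : A.obj.obj a) {b : 𝒜} (f : a ⟶ b) :
    act x b f = (A.obj.map f).hom x := rfl

/-- `x` generates `A`. -/
def IsGenerator {a : 𝒜} (x : A.obj.obj a) : Prop := ∀ b, Function.Surjective (act x b)

/-- The subfunctor generated by an element. -/
def AddSubfunctor.gen {a : 𝒜} (x : A.obj.obj a) : AddSubfunctor A where
  obj b := (act x b).range
  map_mem {b c} f {y} hy := by
    obtain ⟨g, rfl⟩ := hy
    exact ⟨g ≫ f, map_comp_apply g f x⟩

lemma AddSubfunctor.gen_le {a : 𝒜} {x : A.obj.obj a} {B : AddSubfunctor A} (hx : x ∈ B.obj a) :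
    AddSubfunctor.gen x ≤ B := by
  rintro b _ ⟨f, rfl⟩
  exact B.map_mem f hx

lemma AddSubfunctor.self_mem_gen {a : 𝒜} (x : A.obj.obj a) :
    x ∈ (AddSubfunctor.gen x).obj a :=
  ⟨𝟙 a, map_id_apply a x⟩

lemma isGenerator_iff {a : 𝒜} {x : A.obj.obj a} :
    IsGenerator x ↔ ∀ B : AddSubfunctor A, B.IsProper → x ∉ B.obj a := by
  constructor
  · rintro h B ⟨b, hb⟩ hx
    refine hb ((AddSubgroup.eq_top_iff' _).2 fun y => ?_)
    obtain ⟨f, rfl⟩ := h b y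
    exact B.map_mem f hx
  · intro h b
    by_contra hb
    refine h (AddSubfunctor.gen x) ⟨b, fun hb' => hb ?_⟩ (AddSubfunctor.self_mem_gen x)
    exact AddMonoidHom.range_eq_top.1 hb'

/-- `c` cogenerates `A`: nonzero elements of `A` are detected by morphisms to `c`. -/
def IsCogenerating (A : 𝒜 ⥤+ AddCommGrpCat.{w}) (c : 𝒜) : Prop :=
  ∀ (a : 𝒜) (x : A.obj.obj a), (∀ f : a ⟶ c, (A.obj.map f).hom x = 0) → x = 0

lemma AddSubfunctor.IsNonzero.exists_mem {c : 𝒜} (hc : IsCogenerating A c) {B : AddSubfunctor A}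
    (hB : B.IsNonzero) : ∃ x ∈ B.obj c, x ≠ 0 := by
  obtain ⟨a, ha⟩ := hB
  obtain ⟨⟨x, hx⟩, hx0⟩ := AddSubgroup.ne_bot_iff_exists_ne_zero.1 ha
  by_contra! h
  exact hx0 (Subtype.ext <| hc a x fun f => h _ (B.map_mem f hx))

variable [HasZeroObject 𝒜] [HasBinaryBiproducts 𝒜]

variable (A) in
-- Take `x` whose generated subfunctor is maximal. For any other `y`, the element `(x, y)` of `A(a ⊞
-- b)` generates both, so maximality puts `y` in the subfunctor generated by `x`.
lemma exists_isGenerator [WellFoundedGT (AddSubfunctor A)] :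
    ∃ (a : 𝒜) (x : A.obj.obj a), IsGenerator x := by
  let S : Set (AddSubfunctor A) := {B | ∃ (a : 𝒜) (x : A.obj.obj a), B = AddSubfunctor.gen x}
  obtain ⟨o, -⟩ := ‹HasZeroObject 𝒜›
  obtain ⟨_, ⟨a, x, rfl⟩, hmax⟩ := wellFounded_gt.has_min S ⟨_, o, 0, rfl⟩
  refine ⟨a, x, fun b y => ?_⟩
  let z := (A.obj.map (biprod.inl : a ⟶ a ⊞ b)).hom x + (A.obj.map biprod.inr).hom y
  have hx : (A.obj.map biprod.fst).hom z = x := by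
    simp only [z, map_add, ← map_comp_apply]
    simp
  have hy : (A.obj.map biprod.snd).hom z = y := by
    simp only [z, map_add, ← map_comp_apply]
    simp
  have hle : AddSubfunctor.gen x ≤ AddSubfunctor.gen z :=
    AddSubfunctor.gen_le ⟨biprod.fst, hx⟩
  have heq : AddSubfunctor.gen z ≤ AddSubfunctor.gen x := by
    by_contra hlt
    exact hmax _ ⟨_, z, rfl⟩ (lt_of_le_not_ge hle hlt)
  exact heq b ⟨biprod.snd, hy⟩

variable (A) in
-- Dual argument: let `K c` consist of the elements killed by all morphisms to `c`, and choose it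
-- minimal. Since `K (c ⊞ a)` is contained in `K c`, they agree, so an element of `A(a)` killed by
-- morphisms to `c` is also killed by the identity of `a`.
lemma exists_isCogenerating [WellFoundedLT (AddSubfunctor A)] : ∃ c, IsCogenerating A c := by
  let K : 𝒜 → AddSubfunctor A := fun c =>
    { obj a := ⨅ f : a ⟶ c, (A.obj.map f).hom.ker
      map_mem {a b} f {x} hx := by
        simp only [AddSubgroup.mem_iInf, AddMonoidHom.mem_ker] at hx ⊢
        intro g
        rw [← map_comp_apply, hx] }
  have hK : ∀ {c a : 𝒜} {x : A.obj.obj a},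
      x ∈ (K c).obj a ↔ ∀ f : a ⟶ c, (A.obj.map f).hom x = 0 := by
    simp [K, AddSubgroup.mem_iInf]
  obtain ⟨o, -⟩ := ‹HasZeroObject 𝒜›
  obtain ⟨_, ⟨c, rfl⟩, hmin⟩ := wellFounded_lt.has_min (Set.range K) ⟨_, o, rfl⟩
  refine ⟨c, fun a x hx => ?_⟩
  have hle : K (c ⊞ a) ≤ K c := fun b y hy => hK.2 fun f => by
    have := hK.1 hy (f ≫ biprod.inl)
    have h2 := congrArg (A.obj.map biprod.fst).hom this
    rw [← map_comp_apply, map_zero] at h2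
    simpa using h2
  have hge : K c ≤ K (c ⊞ a) := by
    by_contra hlt
    exact hmin _ ⟨_, rfl⟩ (lt_of_le_not_ge hle hlt)
  have := hK.1 (hge a (hK.2 hx)) biprod.inr
  have h2 := congrArg (A.obj.map biprod.snd).hom this
  rw [← map_comp_apply, map_zero] at h2
  simpa using h2

end Generators

end AddRepLin

end

noncomputable section

namespace AddRepLin

variable (k : Type w) [Field k] {𝒜 : Type u} [Category.{v} 𝒜] [Preadditive 𝒜]

/-! ### Generators and morphisms out of a generated functor -/

section Elements

variable (A : 𝒜 ⥤+ AddCommGrpCat.{w})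

/-- The proper subfunctors of `A` span the elements which do not generate `A`. -/
lemma properSum_eq_supported (a : 𝒜) :
    properSum k A a = Finsupp.supported k k {y : A.obj.obj a | ¬ IsGenerator y} := by
  refine le_antisymm (iSup₂_le fun B hB => ?_) ?_
  · rw [Finsupp.range_lmapDomain, Submodule.span_le]
    rintro _ ⟨y, rfl⟩
    exact Finsupp.single_mem_supported k 1 fun hy => isGenerator_iff.1 hy B hB y.2
  · rw [Finsupp.supported_eq_span_single, Submodule.span_le]
    rintro _ ⟨y, hy, rfl⟩
    have hy' : ¬ ∀ B : AddSubfunctor A, B.IsProper → y ∉ B.obj a := fun h =>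
      hy (isGenerator_iff.2 h)
    push Not at hy'
    obtain ⟨B, hB, hyB⟩ := hy'
    exact Submodule.mem_iSup_of_mem B (Submodule.mem_iSup_of_mem hB
      ⟨Finsupp.single ⟨y, hyB⟩ 1, Finsupp.mapDomain_single⟩)

variable {k A}

lemma mem_quotKer_iff {a : 𝒜} {x : A.obj.obj a →₀ k} :
    x ∈ quotKer k A a ↔ ∀ B : AddSubfunctor A, B.IsNonzero →
      Finsupp.mapDomain (QuotientAddGroup.mk' (B.obj a)) x = 0 := by
  simp only [quotKer, Submodule.mem_iInf, LinearMap.mem_ker, Finsupp.lmapDomain_apply]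

lemma IsGenerator.finite {a : 𝒜} {x : A.obj.obj a} (hx : IsGenerator x)
    (h𝒜 : IsTrivialFor k 𝒜) (b : 𝒜) : Finite (A.obj.obj b) := by
  have := (h𝒜 a b).1
  exact Finite.of_surjective _ (hx b)

lemma IsGenerator.hom_ext {B : 𝒜 ⥤+ AddCommGrpCat.{w}} {a : 𝒜} {x : A.obj.obj a}
    (hx : IsGenerator x) {φ ψ : A ⟶ B}
    (h : (φ.hom.app a).hom x = (ψ.hom.app a).hom x) : φ = ψ := by
  refine addHom_ext fun b y => ?_
  obtain ⟨f, rfl⟩ := hx b y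
  rw [act_apply, addHom_naturality, addHom_naturality, h]

/-- A generator presents `A` as a quotient of `Hom(a, -)`, so the Yoneda lemma descends to elements
annihilated by whatever annihilates `x`. -/
lemma IsGenerator.exists_hom {B : 𝒜 ⥤+ AddCommGrpCat.{w}} {a : 𝒜} {x : A.obj.obj a}
    (hx : IsGenerator x) (y : B.obj.obj a)
    (h : ∀ (b : 𝒜) (f : a ⟶ b), (A.obj.map f).hom x = 0 → (B.obj.map f).hom y = 0) :
    ∃ φ : A ⟶ B, (φ.hom.app a).hom x = y := by
  let l : ∀ b, A.obj.obj b →+ B.obj.obj b := fun b =>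
    AddMonoidHom.liftOfSurjective (act x b) (hx b) ⟨act y b, fun f hf => h b f hf⟩
  have hl : ∀ (b : 𝒜) (f : a ⟶ b), l b ((A.obj.map f).hom x) = (B.obj.map f).hom y :=
    fun b f => AddMonoidHom.liftOfRightInverse_comp_apply (act x b) _ _
      ⟨act y b, fun f hf => h b f hf⟩ f
  refine ⟨addHomMk l fun {b c} f z => ?_, ?_⟩
  · obtain ⟨g, rfl⟩ := hx b z
    rw [act_apply, ← map_comp_apply, hl, hl, map_comp_apply]
  · have := hl a (𝟙 a)
    rwa [map_id_apply, map_id_apply] at this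

/-- One inclusion of annihilators suffices: the endomorphism sending `x` to `y` is surjective
because `y` generates, hence bijective by finiteness. -/
lemma IsGenerator.exists_aut [∀ b, Finite (A.obj.obj b)] {a : 𝒜} {x y : A.obj.obj a}
    (hx : IsGenerator x) (hy : IsGenerator y)
    (h : ∀ (b : 𝒜) (f : a ⟶ b), (A.obj.map f).hom x = 0 → (A.obj.map f).hom y = 0) :
    ∃ α : Aut A, (α.hom.hom.app a).hom x = y := by
  obtain ⟨φ, hφ⟩ := hx.exists_hom y h
  have hsurj : ∀ b, Function.Surjective (φ.hom.app b).hom := fun b z => by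
    obtain ⟨f, rfl⟩ := hy b z
    exact ⟨(A.obj.map f).hom x, by rw [addHom_naturality, hφ, act_apply]⟩
  obtain ⟨ψ, hψ⟩ := hy.exists_hom x fun b f hf => by
    have hinj := Finite.injective_iff_surjective.2 (hsurj b)
    refine hinj ?_
    rw [map_zero, addHom_naturality, hφ, hf]
  refine ⟨⟨φ, ψ, hx.hom_ext ?_, hy.hom_ext ?_⟩, hφ⟩
  · change (ψ.hom.app a).hom ((φ.hom.app a).hom x) = x
    rw [hφ, hψ]
  · change (φ.hom.app a).hom ((ψ.hom.app a).hom y) = y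
    rw [hψ, hφ]

/-- The subfunctor of elements `f x`, for all `f` with `f y = 0`. -/
def annImage {a : 𝒜} (x y : A.obj.obj a) : AddSubfunctor A where
  obj b := (act y b).ker.map (act x b)
  map_mem {b c} f {z} hz := by
    obtain ⟨g, hg, rfl⟩ := hz
    refine ⟨g ≫ f, ?_, map_comp_apply g f x⟩
    have hg' : (A.obj.map g).hom y = 0 := hg
    change (A.obj.map (g ≫ f)).hom y = 0
    rw [map_comp_apply, hg', map_zero]

/-- If this subfunctor vanished, every morphism killing `y` would kill `x`, and an automorphism
would carry `y` to `x`. -/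
lemma annImage_isNonzero [∀ b, Finite (A.obj.obj b)] {a : 𝒜} {x y : A.obj.obj a}
    (hx : IsGenerator x) (hy : IsGenerator y)
    (h : ∀ α : Aut A, (α.hom.hom.app a).hom y ≠ x) : (annImage x y).IsNonzero := by
  by_contra h0
  simp only [AddSubfunctor.IsNonzero, not_exists, not_not] at h0
  obtain ⟨α, hα⟩ := hy.exists_aut hx fun b f hf =>
    (AddSubgroup.eq_bot_iff_forall _).1 (h0 b) _ ⟨f, hf, rfl⟩
  exact h α hα

end Elements

/-! ### Separating orbits of generators by averaging -/

section Translation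

variable {k}

lemma mapDomain_add_right_comm {G H : Type*} [AddCommGroup G] [AddCommGroup H] (e : G →+ H)
    (g : G) (u : G →₀ k) : Finsupp.mapDomain e (Finsupp.mapDomain (· + g) u) =
      Finsupp.mapDomain (· + e g) (Finsupp.mapDomain e u) := by
  rw [← Finsupp.mapDomain_comp, ← Finsupp.mapDomain_comp]
  congr 1
  ext x
  simp

/-- The sum of all translates of `ξ` by `K` depends only on the image of `ξ` in `k[G/e(K)]`. -/
lemma sum_translate_eq_zero {G K : Type*} [AddCommGroup G] [AddCommGroup K] [Fintype K]
    (e : K →+ G) (ξ : G →₀ k)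
    (h : Finsupp.mapDomain (QuotientAddGroup.mk' e.range) ξ = 0) :
    ∑ z : K, Finsupp.mapDomain (· + e z) ξ = 0 := by
  -- A coset goes to the sum of the translates of a representative; another representative only
  -- permutes the terms.
  let φ : (G ⧸ e.range →₀ k) →ₗ[k] (G →₀ k) := Finsupp.lsum k fun q =>
    ∑ z : K, Finsupp.lsingle (Quotient.out q + e z)
  have hφ : φ ∘ₗ Finsupp.lmapDomain k k (QuotientAddGroup.mk' e.range) =
      ∑ z : K, Finsupp.lmapDomain k k (· + e z) := by
    ext y : 2
    obtain ⟨z₀, hz₀⟩ : -Quotient.out (QuotientAddGroup.mk' e.range y) + y ∈ e.range :=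
      QuotientAddGroup.eq.1 (Quotient.out_eq _)
    simp only [φ, LinearMap.comp_apply, Finsupp.lsingle_apply, Finsupp.lmapDomain_apply,
      Finsupp.mapDomain_single, Finsupp.lsum_single, LinearMap.sum_apply]
    rw [← Equiv.sum_comp (Equiv.addLeft z₀)]
    refine Finset.sum_congr rfl fun z _ => ?_
    simp [hz₀, ← add_assoc]
  have := LinearMap.congr_fun hφ ξ
  rw [LinearMap.comp_apply, Finsupp.lmapDomain_apply, h, map_zero] at this
  simpa using this.symm

end Translation

section Separation

variable {k} {A : 𝒜 ⥤+ AddCommGrpCat.{w}}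

/-- Elements of `Q^A(b)` can be reached from a generator `x` by a linear combination of morphisms
which kills any given finite set of generators outside the orbit of `x`. -/
lemma exists_separating (h𝒜 : IsTrivialFor k 𝒜) {a b : 𝒜} {x : A.obj.obj a} (hx : IsGenerator x)
    (s : Finset (A.obj.obj a)) (hs : ∀ y ∈ s, IsGenerator y)
    (hs' : ∀ y ∈ s, ∀ α : Aut A, (α.hom.hom.app a).hom y ≠ x)
    {ξ : A.obj.obj b →₀ k} (hξ : ξ ∈ quotKer k A b) :
    ∃ u : (a ⟶ b) →₀ k, Finsupp.mapDomain (act x b) u = ξ ∧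
      ∀ y ∈ s, Finsupp.mapDomain (act y b) u = 0 := by
  classical
  have : ∀ b, Finite (A.obj.obj b) := hx.finite h𝒜
  have := (h𝒜 a b).1
  have := Fintype.ofFinite (a ⟶ b)
  induction s using Finset.induction_on with
  | empty =>
    obtain ⟨u, hu⟩ := Finsupp.mapDomain_surjective (hx b) ξ
    exact ⟨u, hu, by simp⟩
  | insert y s _ ih =>
    obtain ⟨u, hu, hu'⟩ := ih (fun z hz => hs z (Finset.mem_insert_of_mem hz))
      fun z hz => hs' z (Finset.mem_insert_of_mem hz)
    let K := (act y b).ker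
    have hK : (Fintype.card K : k) ≠ 0 := by
      intro h0
      have h1 : (Nat.card (a ⟶ b) : k) ≠ 0 := (h𝒜 a b).2.ne_zero
      apply h1
      obtain ⟨m, hm⟩ := K.card_addSubgroup_dvd_card
      rw [hm, Nat.cast_mul, Nat.card_eq_fintype_card, h0, zero_mul]
    -- Subtract from `u` its average over translations by `K`. Applied to `y` these translations are
    -- trivial, so the difference dies. Applied to `x` they are translations by the nonzero
    -- subfunctor `annImage x y`, so the average of `ξ ∈ Q^A` vanishes. Earlier vanishing conditions
    -- are preserved.
    let v := ∑ z : K, Finsupp.mapDomain (· + (z : a ⟶ b)) u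
    have hv : ∀ y : A.obj.obj a, Finsupp.mapDomain (act y b) v =
        ∑ z : K, Finsupp.mapDomain (· + act y b z) (Finsupp.mapDomain (act y b) u) := by
      intro y
      simp only [v, Finsupp.mapDomain_finsetSum, mapDomain_add_right_comm]
    refine ⟨u - (Fintype.card K : k)⁻¹ • v, ?_, ?_⟩
    · have h0 : Finsupp.mapDomain (act x b) v = 0 := by
        rw [hv, hu]
        refine sum_translate_eq_zero ((act x b).comp K.subtype) ξ ?_
        have hB := mem_quotKer_iff.1 hξ _ (annImage_isNonzero hx
          (hs y (Finset.mem_insert_self y s)) (hs' y (Finset.mem_insert_self y s)))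
        have hr : ((act x b).comp K.subtype).range = (annImage x y).obj b := by
          rw [AddMonoidHom.range_comp, AddSubgroup.range_subtype]
          rfl
        rw [hr]
        exact hB
      change Finsupp.lmapDomain k k (act x b) _ = ξ
      rw [map_sub, map_smul, Finsupp.lmapDomain_apply, Finsupp.lmapDomain_apply, h0, smul_zero,
        sub_zero, hu]
    · intro z hz
      change Finsupp.lmapDomain k k (act z b) _ = 0
      rw [map_sub, map_smul, Finsupp.lmapDomain_apply, Finsupp.lmapDomain_apply, hv]
      rcases Finset.mem_insert.1 hz with rfl | hz
      · have h0 : ∀ f : K, act z b f = 0 := fun f => f.2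
        simp only [h0, add_zero]
        rw [show (fun t : A.obj.obj b => t) = id from rfl, Finsupp.mapDomain_id, Finset.sum_const,
          Finset.card_univ, ← Nat.cast_smul_eq_nsmul k, smul_smul, inv_mul_cancel₀ hK, one_smul,
          sub_self]
      · simp [hu' z hz]

end Separation

/-! ### Nonvanishing of `Q^A` -/

section Nonvanishing

variable {k} {A : 𝒜 ⥤+ AddCommGrpCat.{w}}

lemma mapDomain_mk_translate {a : 𝒜} (B : AddSubfunctor A) (y : A.obj.obj a)
    (ζ : A.obj.obj a →₀ k) (h : Finsupp.mapDomain (QuotientAddGroup.mk' (B.obj a)) ζ = 0) :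
    Finsupp.mapDomain (QuotientAddGroup.mk' (B.obj a)) (Finsupp.mapDomain (· + y) ζ) = 0 := by
  rw [mapDomain_add_right_comm, h, Finsupp.mapDomain_zero]

lemma mapDomain_mk_linMap {a b : 𝒜} (B : AddSubfunctor A) (f : a ⟶ b)
    (ζ : A.obj.obj a →₀ k) (h : Finsupp.mapDomain (QuotientAddGroup.mk' (B.obj a)) ζ = 0) :
    Finsupp.mapDomain (QuotientAddGroup.mk' (B.obj b)) (linMap k A f ζ) = 0 :=
  lmapDomain_ker_le k _ (QuotientAddGroup.mk' (B.obj b)) _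
    (QuotientAddGroup.map (B.obj a) (B.obj b) (A.obj.map f).hom fun _ hx => B.map_mem f hx)
    (fun _ => rfl) h

lemma map_injective_of_split {a b : 𝒜} (i : a ⟶ b) (p : b ⟶ a) (h : i ≫ p = 𝟙 a) :
    Function.Injective (A.obj.map i).hom := by
  intro x y hxy
  have := congrArg (A.obj.map p).hom hxy
  rwa [← map_comp_apply, ← map_comp_apply, h, map_id_apply, map_id_apply] at this

variable (k) in
-- Take the external product of the differences `[y] - [0]` over all nonzero `y ∈ A(c)`, each in its
-- own copy of `c`. A nonzero `B` contains some such `y`, which kills that factor in `k[A/B]`; the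
-- separate copies keep the product nonzero.
lemma exists_mem_quotKer_ne_zero [HasBinaryBiproducts 𝒜] {c : 𝒜} (hc : IsCogenerating A c)
    [Finite (A.obj.obj c)] : ∃ (d : 𝒜) (ζ : A.obj.obj d →₀ k), ζ ∈ quotKer k A d ∧ ζ ≠ 0 := by
  classical
  have key : ∀ s : Finset (A.obj.obj c), (∀ y ∈ s, y ≠ 0) → ∃ (d : 𝒜) (ζ : A.obj.obj d →₀ k),
      (∀ B : AddSubfunctor A, (∃ y ∈ s, y ∈ B.obj c) →
        Finsupp.mapDomain (QuotientAddGroup.mk' (B.obj d)) ζ = 0) ∧ ζ ≠ 0 := by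
    intro s
    induction s using Finset.induction_on with
    | empty =>
      exact fun _ => ⟨c, Finsupp.single 0 1, by simp, by simp⟩
    | insert y s _ ih =>
      intro hs
      obtain ⟨d, ζ, hζ, hζ0⟩ := ih fun z hz => hs z (Finset.mem_insert_of_mem hz)
      let y' := (A.obj.map (biprod.inr : c ⟶ d ⊞ c)).hom y
      let η := linMap k A (biprod.inl : d ⟶ d ⊞ c) ζ
      refine ⟨d ⊞ c, Finsupp.mapDomain (· + y') η - η, fun B hB => ?_, fun h0 => ?_⟩
      · change Finsupp.lmapDomain k k _ _ = 0
        rw [map_sub, Finsupp.lmapDomain_apply, Finsupp.lmapDomain_apply]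
        obtain ⟨z, hz, hzB⟩ := hB
        rcases Finset.mem_insert.1 hz with rfl | hz
        · have : QuotientAddGroup.mk' (B.obj (d ⊞ c)) y' = 0 :=
            (QuotientAddGroup.eq_zero_iff _).2 (B.map_mem _ hzB)
          rw [mapDomain_add_right_comm, this]
          simp only [add_zero]
          exact sub_eq_zero.2 Finsupp.mapDomain_id
        · have := mapDomain_mk_linMap B (biprod.inl : d ⟶ d ⊞ c) ζ (hζ B ⟨z, hz, hzB⟩)
          rw [mapDomain_mk_translate B _ _ this, this, sub_zero]
      · obtain ⟨x, hx⟩ := Finsupp.ne_iff.1 hζ0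
        -- At the point `(x, y)` the translate contributes `ζ x`, while `η` is supported on points
        -- with second coordinate zero.
        have h1 := DFunLike.congr_fun h0 ((A.obj.map (biprod.inl : d ⟶ d ⊞ c)).hom x + y')
        rw [Finsupp.sub_apply, Finsupp.mapDomain_apply (add_left_injective y')] at h1
        have h2 : η ((A.obj.map (biprod.inl : d ⟶ d ⊞ c)).hom x) = ζ x :=
          Finsupp.mapDomain_apply (map_injective_of_split _ biprod.fst biprod.inl_fst) ζ x
        have h3 : η ((A.obj.map (biprod.inl : d ⟶ d ⊞ c)).hom x + y') = 0 := by
          refine Finsupp.mapDomain_of_notMem_range _ _ ?_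
          rintro ⟨t, ht⟩
          have := congrArg (A.obj.map biprod.snd).hom ht
          simp only [y', map_add, ← map_comp_apply] at this
          simp at this
          exact hs y (Finset.mem_insert_self y s) this.symm
        rw [h2, h3, sub_zero] at h1
        exact hx h1
  have := Fintype.ofFinite (A.obj.obj c)
  obtain ⟨d, ζ, hζ, hζ0⟩ := key (Finset.univ.filter (· ≠ 0)) (by simp)
  refine ⟨d, ζ, mem_quotKer_iff.2 fun B hB => hζ B ?_, hζ0⟩
  obtain ⟨y, hy, hy0⟩ := hB.exists_mem hc
  exact ⟨y, by simpa using hy0, hy⟩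

end Nonvanishing

end AddRepLin

end

/-! ### The tensor products of `M` with `Q_A` and `Q^A` over `Aut(A)` -/

noncomputable section

namespace AddRepLin

variable {k : Type w} [Field k] {𝒜 : Type u} [Category.{v} 𝒜] [Preadditive 𝒜]
  {A : 𝒜 ⥤+ AddCommGrpCat.{w}} (M : Rep.{w} k (Aut A))

/-- The functor `M ⊗_{k[Aut(A)]} Q_A`. -/
def tensorLower : 𝒜 ⥤ ModuleCat.{w} k :=
  Qlower k A ⋙ (Rep.coinvariantsTensor k (Aut A)).obj M

/-- The functor `M ⊗_{k[Aut(A)]} Q^A`. -/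
def tensorUpper : 𝒜 ⥤ ModuleCat.{w} k :=
  Qupper k A ⋙ (Rep.coinvariantsTensor k (Aut A)).obj M

/-- The canonical morphism `M ⊗_{k[Aut(A)]} Q^A ⟶ M ⊗_{k[Aut(A)]} Q_A`. -/
def tensorHom : tensorUpper M ⟶ tensorLower M :=
  Functor.whiskerRight (QupperToQlower k A) ((Rep.coinvariantsTensor k (Aut A)).obj M)

/-- The class of `m ⊗ x` in `M ⊗_{k[Aut(A)]} Q_A(a)`. -/
def tmk (a : 𝒜) : M →ₗ[k] (A.obj.obj a →₀ k) →ₗ[k] (tensorLower M).obj a :=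
  (Rep.coinvariantsTensorMk M ((Qlower k A).obj a)).compl₂ (properSum k A a).mkQ

variable {M}

lemma tmk_act (a : 𝒜) (g : Aut A) (m : M) (x : A.obj.obj a →₀ k) :
    tmk M a (M.ρ g m) (linRep k A a g x) = tmk M a m x :=
  Representation.Coinvariants.mk_self_apply (M.ρ.tprod (QlowerRep k A a)) g
    (m ⊗ₜ[k] (properSum k A a).mkQ x)

lemma tmk_eq_zero {a : 𝒜} (m : M) {x : A.obj.obj a →₀ k} (hx : x ∈ properSum k A a) :
    tmk M a m x = 0 := by
  have : (properSum k A a).mkQ x = 0 := by simpa using hx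
  exact (congrArg (Rep.coinvariantsTensorMk M ((Qlower k A).obj a) m) this).trans (map_zero _)

lemma map_tmk {a b : 𝒜} (f : a ⟶ b) (m : M) (x : A.obj.obj a →₀ k) :
    ((tensorLower M).map f).hom (tmk M a m x) = tmk M b m (linMap k A f x) := rfl

lemma tensorLower_induction {a : 𝒜} {p : (tensorLower M).obj a → Prop}
    (h0 : p 0) (hadd : ∀ s t, p s → p t → p (s + t)) (h : ∀ m x, p (tmk M a m x))
    (t : (tensorLower M).obj a) : p t := by
  obtain ⟨t, rfl⟩ := Representation.Coinvariants.mk_surjective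
    (M.ρ.tprod (QlowerRep k A a)) t
  induction t using TensorProduct.induction_on with
  | zero => exact h0
  | add x y hx hy => exact hadd _ _ hx hy
  | tmul m y =>
    obtain ⟨x, rfl⟩ := (properSum k A a).mkQ_surjective y
    exact h m x

lemma tensorLower_hom_ext {a : 𝒜} {W : Type*} [AddCommGroup W] [Module k W]
    {f g : (tensorLower M).obj a →ₗ[k] W} (h : ∀ m x, f (tmk M a m x) = g (tmk M a m x)) :
    f = g :=
  LinearMap.ext fun t => tensorLower_induction (p := fun t => f t = g t) (by simp)
    (fun s t hs ht => by simp [hs, ht]) h t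

/-- Linear maps out of `M ⊗_{k[Aut(A)]} Q_A(a)`. -/
lemma exists_tensorLower_lift {a : 𝒜} {W : Type*} [AddCommGroup W] [Module k W]
    (β : M →ₗ[k] (A.obj.obj a →₀ k) →ₗ[k] W)
    (hβ : ∀ (g : Aut A) (m : M) (x : A.obj.obj a →₀ k), β (M.ρ g m) (linRep k A a g x) = β m x)
    (hβ' : ∀ m, ∀ x ∈ properSum k A a, β m x = 0) :
    ∃ φ : (tensorLower M).obj a →ₗ[k] W, ∀ m x, φ (tmk M a m x) = β m x := by
  let γ : M →ₗ[k] ((A.obj.obj a →₀ k) ⧸ properSum k A a) →ₗ[k] W :=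
    { toFun m := (properSum k A a).liftQ (β m) fun x hx => hβ' m x hx
      map_add' m m' := Submodule.linearMap_qext _ (LinearMap.ext fun x =>
        LinearMap.congr_fun (map_add β m m') x)
      map_smul' r m := Submodule.linearMap_qext _ (LinearMap.ext fun x =>
        LinearMap.congr_fun (map_smul β r m) x) }
  refine ⟨Representation.Coinvariants.lift (M.ρ.tprod (QlowerRep k A a)) (TensorProduct.lift γ)
    fun g => ?_, fun m x => ?_⟩
  · refine TensorProduct.ext (LinearMap.ext fun m => Submodule.linearMap_qext _
      (LinearMap.ext fun x => ?_))
    exact hβ g m x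
  · rfl

lemma tensorHom_range {a : 𝒜} {N : Submodule k ((tensorLower M).obj a)} :
    LinearMap.range ((tensorHom M).app a).hom ≤ N ↔
      ∀ m : M, ∀ x ∈ quotKer k A a, tmk M a m x ∈ N := by
  constructor
  · intro h m x hx
    refine h ⟨Rep.coinvariantsTensorMk M ((Qupper k A).obj a) m (⟨x, hx⟩ : quotKer k A a), rfl⟩
  · rintro h _ ⟨t, rfl⟩
    obtain ⟨t, rfl⟩ := Representation.Coinvariants.mk_surjective
      (M.ρ.tprod (QupperRep k A a)) t
    induction t using TensorProduct.induction_on with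
    | zero => exact (congrArg (· ∈ N) (map_zero ((tensorHom M).app a).hom)).mpr N.zero_mem
    | add x y hx hy =>
      exact (congrArg (· ∈ N) (map_add ((tensorHom M).app a).hom _ _)).mpr (N.add_mem hx hy)
    | tmul m y => exact h m y.1 y.2

/-! ### Detecting nonzero tensors through the free action on generators -/

section Detection

lemma linRep_single (a : 𝒜) (g : Aut A) (y : A.obj.obj a) (r : k) :
    linRep k A a g (Finsupp.single y r) = Finsupp.single ((g.hom.hom.app a).hom y) r :=
  Finsupp.mapDomain_single

lemma linMap_single {a b : 𝒜} (f : a ⟶ b) (y : A.obj.obj a) (r : k) :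
    linMap k A f (Finsupp.single y r) = Finsupp.single ((A.obj.map f).hom y) r :=
  Finsupp.mapDomain_single

lemma IsGenerator.aut_apply {a : 𝒜} {z : A.obj.obj a} (hz : IsGenerator z) (α : Aut A) :
    IsGenerator ((α.hom.hom.app a).hom z) := by
  intro b y
  obtain ⟨f, hf⟩ := hz b ((α.inv.hom.app b).hom y)
  refine ⟨f, ?_⟩
  rw [act_apply] at hf
  rw [act_apply, ← addHom_naturality, hf]
  exact addHom_congr α.inv_hom_id b y

lemma IsGenerator.aut_ext {a : 𝒜} {z : A.obj.obj a} (hz : IsGenerator z) {α β : Aut A}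
    (h : (α.hom.hom.app a).hom z = (β.hom.hom.app a).hom z) : α = β :=
  Iso.ext (hz.hom_ext h)

lemma IsGenerator.of_map {a b : 𝒜} {z : A.obj.obj a} (f : a ⟶ b)
    (h : IsGenerator ((A.obj.map f).hom z)) : IsGenerator z := by
  intro c y
  obtain ⟨g, rfl⟩ := h c y
  exact ⟨f ≫ g, map_comp_apply f g z⟩

variable {V : Type*} [AddCommGroup V] [Module k V] (ρ : Representation k (Aut A) V)

open Classical in
/-- The operator `ρ(α)⁻¹`, if `y = α z`, and zero if `y` is not in the orbit of `z`. -/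
def orbitMap {a : 𝒜} (z y : A.obj.obj a) : V →ₗ[k] V :=
  if h : ∃ α : Aut A, (α.hom.hom.app a).hom z = y then ρ h.choose⁻¹ else 0

lemma orbitMap_apply_aut {a : 𝒜} {z : A.obj.obj a} (hz : IsGenerator z) (α : Aut A) :
    orbitMap ρ z ((α.hom.hom.app a).hom z) = ρ α⁻¹ := by
  have h : ∃ β : Aut A, (β.hom.hom.app a).hom z = (α.hom.hom.app a).hom z := ⟨α, rfl⟩
  rw [orbitMap, dif_pos h, hz.aut_ext h.choose_spec]

lemma orbitMap_self {a : 𝒜} {z : A.obj.obj a} (hz : IsGenerator z) :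
    orbitMap ρ z z = LinearMap.id := by
  have := orbitMap_apply_aut ρ hz 1
  rw [inv_one, map_one] at this
  exact this

lemma orbitMap_eq_zero {a : 𝒜} {z y : A.obj.obj a}
    (h : ¬ ∃ α : Aut A, (α.hom.hom.app a).hom z = y) : orbitMap ρ z y = 0 :=
  dif_neg h

/-- This invariance makes the pairing `(v, y) ↦ orbitMap ρ z y v` descend to coinvariants. -/
lemma orbitMap_aut {a : 𝒜} {z : A.obj.obj a} (hz : IsGenerator z) (y : A.obj.obj a) (g : Aut A)
    (v : V) : orbitMap ρ z ((g.hom.hom.app a).hom y) (ρ g v) = orbitMap ρ z y v := by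
  by_cases h : ∃ α : Aut A, (α.hom.hom.app a).hom z = y
  · obtain ⟨α, rfl⟩ := h
    have : (g.hom.hom.app a).hom ((α.hom.hom.app a).hom z) = ((g * α).hom.hom.app a).hom z := rfl
    rw [this, orbitMap_apply_aut ρ hz, orbitMap_apply_aut ρ hz, mul_inv_rev, map_mul,
      Module.End.mul_apply, ρ.inv_self_apply]
  · rw [orbitMap_eq_zero ρ h, orbitMap_eq_zero]
    · rfl
    · rintro ⟨α, hα⟩
      refine h ⟨g⁻¹ * α, ?_⟩
      change (g.inv.hom.app a).hom ((α.hom.hom.app a).hom z) = y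
      rw [hα]
      exact addHom_congr g.hom_inv_id a y

lemma linearCombination_orbitMap_linRep {a : 𝒜} {z : A.obj.obj a} (hz : IsGenerator z)
    (g : Aut A) (x : A.obj.obj a →₀ k) (v : V) :
    Finsupp.linearCombination k (orbitMap ρ z) (linRep k A a g x) (ρ g v) =
      Finsupp.linearCombination k (orbitMap ρ z) x v := by
  induction x using Finsupp.induction_linear with
  | zero => simp
  | add x y hx hy => simp only [map_add, LinearMap.add_apply, hx, hy]
  | single y r =>
    rw [linRep_single, Finsupp.linearCombination_single, Finsupp.linearCombination_single,
      LinearMap.smul_apply, LinearMap.smul_apply, orbitMap_aut ρ hz]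

/-- The orbit of `z` consists of generators, whereas `properSum` is supported on non-generators. -/
lemma linearCombination_orbitMap_of_mem_properSum {a : 𝒜} {z : A.obj.obj a} (hz : IsGenerator z)
    {x : A.obj.obj a →₀ k} (hx : x ∈ properSum k A a) :
    Finsupp.linearCombination k (orbitMap ρ z) x = 0 := by
  rw [properSum_eq_supported] at hx
  rw [Finsupp.linearCombination_apply]
  refine Finset.sum_eq_zero fun y hy => ?_
  dsimp only
  rw [orbitMap_eq_zero ρ, smul_zero]
  rintro ⟨α, rfl⟩
  exact hx hy (hz.aut_apply α)

/-- Replace each point `y` in the support of `ζ` by `(x, y)`. These points are generators because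
`x` is, and they lie in distinct orbits: an automorphism relating two of them fixes `x`, so it is
the identity. The form attached to one orbit then reads off a coefficient of `ζ` times `m`. -/
lemma tmk_ne_zero [HasBinaryBiproducts 𝒜] {a d : 𝒜} {x : A.obj.obj a} (hx : IsGenerator x)
    {ζ : A.obj.obj d →₀ k} (hζ : ζ ∈ quotKer k A d) (hζ0 : ζ ≠ 0) {m : M} (hm : m ≠ 0) :
    ∃ ξ ∈ quotKer k A (a ⊞ d), tmk M (a ⊞ d) m ξ ≠ 0 := by
  let i : A.obj.obj d → A.obj.obj (a ⊞ d) := fun y =>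
    (A.obj.map biprod.inr).hom y + (A.obj.map biprod.inl).hom x
  have hfst : ∀ y, (A.obj.map biprod.fst).hom (i y) = x := fun y => by
    simp only [i, map_add, ← map_comp_apply]
    simp
  have hsnd : ∀ y, (A.obj.map biprod.snd).hom (i y) = y := fun y => by
    simp only [i, map_add, ← map_comp_apply]
    simp
  have hi : Finsupp.mapDomain i ζ = Finsupp.mapDomain (· + (A.obj.map biprod.inl).hom x)
      (linMap k A (biprod.inr : d ⟶ a ⊞ d) ζ) := by
    rw [linMap, Finsupp.lmapDomain_apply, ← Finsupp.mapDomain_comp]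
    rfl
  refine ⟨Finsupp.mapDomain i ζ, mem_quotKer_iff.2 fun B hB => ?_, fun h0 => ?_⟩
  · rw [hi]
    exact mapDomain_mk_translate B _ _ (mapDomain_mk_linMap B _ _ (mem_quotKer_iff.1 hζ B hB))
  · obtain ⟨y₀, hy₀⟩ := Finsupp.ne_iff.1 hζ0
    have hz : IsGenerator (i y₀) := IsGenerator.of_map biprod.fst (by rwa [hfst])
    obtain ⟨φ, hφ⟩ := exists_tensorLower_lift (M := M)
      (Finsupp.linearCombination k (orbitMap M.ρ (i y₀))).flip
      (fun g m x => linearCombination_orbitMap_linRep M.ρ hz g x m)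
      (fun m x hx => by
        rw [LinearMap.flip_apply, linearCombination_orbitMap_of_mem_properSum M.ρ hz hx,
          LinearMap.zero_apply])
    have h1 := hφ m (Finsupp.mapDomain i ζ)
    rw [h0, map_zero, LinearMap.flip_apply, Finsupp.linearCombination_mapDomain,
      Finsupp.linearCombination_apply, Finsupp.sum_eq_single y₀, Function.comp_apply,
      orbitMap_self M.ρ hz] at h1
    · exact smul_ne_zero hy₀ hm h1.symm
    · intro y _ hy
      rw [Function.comp_apply, orbitMap_eq_zero, smul_zero]
      rintro ⟨α, hα⟩
      have hα1 : α = 1 := by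
        refine hx.aut_ext ?_
        have := congrArg (A.obj.map biprod.fst).hom hα
        rwa [← addHom_naturality, hfst, hfst] at this
      subst hα1
      refine hy ?_
      have hα' : i y₀ = i y := hα
      have := congrArg (A.obj.map biprod.snd).hom hα'
      rw [hsnd, hsnd] at this
      exact this.symm
    · simp

/-- The map `q ↦ [x] ⊗ q` embeds `Q_A` into `k[A(a)] ⊗ Q_A`. Since the orbit of `x` is free, a
retraction is given by `[αx] ⊗ q ↦ α⁻¹q`, and by zero on elements outside the orbit. -/
lemma mem_properSum_of_tmk_single_eq_zero {a b : 𝒜} {x : A.obj.obj a} (hx : IsGenerator x)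
    {y : A.obj.obj b →₀ k}
    (h : tmk (Rep.of (linRep k A a)) b (Finsupp.single x 1) y = 0) : y ∈ properSum k A b := by
  let L := Finsupp.linearCombination k (orbitMap (QlowerRep k A b) x)
  obtain ⟨φ, hφ⟩ := exists_tensorLower_lift (M := Rep.of (linRep k A a)) (a := b)
    (L.compl₂ (properSum k A b).mkQ)
    (fun g m y => linearCombination_orbitMap_linRep (QlowerRep k A b) hx g m
      ((properSum k A b).mkQ y))
    (fun m y hy => by
      have : (properSum k A b).mkQ y = 0 := by simpa using hy
      rw [LinearMap.compl₂_apply, this, map_zero])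
  have h1 := hφ (Finsupp.single x 1) y
  rw [h, map_zero, LinearMap.compl₂_apply, Finsupp.linearCombination_single, one_smul,
    orbitMap_self _ hx] at h1
  simpa using h1.symm

end Detection

/-! ### Normal form of tensors and the subfunctor generated by one of them -/

section Separation

lemma exists_finset_sum_eq {a : 𝒜} [Finite (A.obj.obj a)] (t : (tensorLower M).obj a) :
    ∃ (s : Finset (A.obj.obj a)) (μ : A.obj.obj a → M),
      t = ∑ y ∈ s, tmk M a (μ y) (Finsupp.single y 1) := by
  classical
  have := Fintype.ofFinite (A.obj.obj a)
  refine ⟨Finset.univ, ?_⟩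
  induction t using tensorLower_induction with
  | h0 => exact ⟨0, by simp⟩
  | hadd s t hs ht =>
    obtain ⟨μ, rfl⟩ := hs
    obtain ⟨ν, rfl⟩ := ht
    exact ⟨μ + ν, by simp [Finset.sum_add_distrib]⟩
  | h m x =>
    refine ⟨fun y => x y • m, ?_⟩
    conv_lhs => rw [← Finsupp.univ_sum_single x, map_sum]
    refine Finset.sum_congr rfl fun y _ => ?_
    rw [map_smul, LinearMap.smul_apply, ← map_smul, Finsupp.smul_single, smul_eq_mul, mul_one]

/-- Choose an expression with the fewest terms. Non-generators contribute zero, and two terms in one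
orbit could be merged by moving an automorphism across the tensor. -/
lemma exists_minimal_finset_sum {a : 𝒜} [Finite (A.obj.obj a)] (t : (tensorLower M).obj a) :
    ∃ (s : Finset (A.obj.obj a)) (μ : A.obj.obj a → M),
      t = ∑ y ∈ s, tmk M a (μ y) (Finsupp.single y 1) ∧ (∀ y ∈ s, μ y ≠ 0) ∧
      (∀ y ∈ s, IsGenerator y) ∧
      ∀ x ∈ s, ∀ y ∈ s, y ≠ x → ∀ α : Aut A, (α.hom.hom.app a).hom y ≠ x := by
  classical
  have hex : ∃ (n : ℕ) (s : Finset (A.obj.obj a)) (μ : A.obj.obj a → M),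
      s.card = n ∧ t = ∑ y ∈ s, tmk M a (μ y) (Finsupp.single y 1) := by
    obtain ⟨s, μ, h⟩ := exists_finset_sum_eq t
    exact ⟨_, s, μ, rfl, h⟩
  obtain ⟨s, μ, hcard, ht⟩ := Nat.find_spec hex
  have hmin : ∀ y ∈ s, ∀ ν : A.obj.obj a → M,
      t ≠ ∑ z ∈ s.erase y, tmk M a (ν z) (Finsupp.single z 1) := fun y hy ν hν =>
    Nat.find_min hex (hcard ▸ Finset.card_erase_lt_of_mem hy) ⟨_, ν, rfl, hν⟩
  have hne : ∀ y ∈ s, tmk M a (μ y) (Finsupp.single y 1) ≠ 0 := fun y hy h0 =>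
    hmin y hy μ (by rw [ht, ← Finset.add_sum_erase s _ hy, h0, zero_add])
  refine ⟨s, μ, ht, fun y hy h0 => hne y hy (by rw [h0, map_zero, LinearMap.zero_apply]),
    fun y hy => ?_, fun x hx y hy hyx α hα => ?_⟩
  · by_contra hgen
    refine hne y hy (tmk_eq_zero _ ?_)
    rw [properSum_eq_supported]
    exact Finsupp.single_mem_supported k 1 hgen
  · refine hmin y hy (Function.update μ x (μ x + M.ρ α (μ y))) ?_
    have hx' : x ∈ s.erase y := Finset.mem_erase.2 ⟨hyx.symm, hx⟩
    have hy' : tmk M a (μ y) (Finsupp.single y 1) =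
        tmk M a (M.ρ α (μ y)) (Finsupp.single x 1) := by
      rw [← tmk_act a α, linRep_single, hα]
    rw [ht, ← Finset.add_sum_erase s _ hy, ← Finset.add_sum_erase _ _ hx',
      ← Finset.add_sum_erase _ _ hx', Function.update_self, map_add, LinearMap.add_apply, hy',
      ← add_assoc, add_comm (tmk M a (M.ρ α (μ y)) _)]
    refine congrArg₂ _ rfl (Finset.sum_congr rfl fun z hz => ?_)
    rw [Function.update_of_ne (Finset.ne_of_mem_erase hz)]

lemma sum_map_tmk_single {a b : 𝒜} (u : (a ⟶ b) →₀ k) (m : M) (y : A.obj.obj a) :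
    (u.sum fun f r => r • ((tensorLower M).map f).hom (tmk M a m (Finsupp.single y 1))) =
      tmk M b m (Finsupp.mapDomain (act y b) u) := by
  simp only [map_tmk, linMap_single, Finsupp.mapDomain, Finsupp.sum, map_sum, act_apply]
  refine Finset.sum_congr rfl fun f _ => ?_
  rw [← map_smul, Finsupp.smul_single, smul_eq_mul, mul_one]

/-- From a nonzero element of `M ⊗ Q_A`, one obtains `m ⊗ ξ` for some nonzero `m` and all `ξ` in
`Q^A`. -/
lemma exists_sum_map_eq_tmk (h𝒜 : IsTrivialFor k 𝒜) {a₀ : 𝒜} {x₀ : A.obj.obj a₀}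
    (hx₀ : IsGenerator x₀) {a : 𝒜} {t : (tensorLower M).obj a} (ht : t ≠ 0) :
    ∃ m : M, m ≠ 0 ∧ ∀ (b : 𝒜), ∀ ξ ∈ quotKer k A b, ∃ u : (a ⟶ b) →₀ k,
      (u.sum fun f r => r • ((tensorLower M).map f).hom t) = tmk M b m ξ := by
  classical
  have : ∀ b, Finite (A.obj.obj b) := hx₀.finite h𝒜
  obtain ⟨s, μ, hsum, hμ, hgen, horb⟩ := exists_minimal_finset_sum t
  obtain ⟨x, hx⟩ : s.Nonempty := by
    rw [Finset.nonempty_iff_ne_empty]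
    rintro rfl
    exact ht (by simpa using hsum)
  refine ⟨μ x, hμ x hx, fun b ξ hξ => ?_⟩
  obtain ⟨u, hu, hu'⟩ := exists_separating h𝒜 (hgen x hx) (s.erase x)
    (fun y hy => hgen y (Finset.mem_of_mem_erase hy))
    (fun y hy => horb x hx y (Finset.mem_of_mem_erase hy) (Finset.ne_of_mem_erase hy)) hξ
  refine ⟨u, ?_⟩
  have : (u.sum fun f r => r • ((tensorLower M).map f).hom t) =
      ∑ y ∈ s, tmk M b (μ y) (Finsupp.mapDomain (act y b) u) := by
    simp only [← sum_map_tmk_single, hsum, Finsupp.sum, map_sum, Finset.smul_sum]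
    exact Finset.sum_comm
  rw [this, ← Finset.add_sum_erase s _ hx, hu, Finset.sum_eq_zero, add_zero]
  intro y hy
  rw [hu' y hy, map_zero]

end Separation

end AddRepLin

end

noncomputable section

namespace AddRepLin

variable {k : Type w} [Field k] {𝒜 : Type u} [Category.{v} 𝒜]

/-! ### Functors to vector spaces and linearization -/

section FunctorElements

variable {F G H : 𝒜 ⥤ ModuleCat.{w} k}

lemma natTrans_naturality_apply (φ : F ⟶ G) {a b : 𝒜} (f : a ⟶ b) (x : F.obj a) :
    (φ.app b).hom ((F.map f).hom x) = (G.map f).hom ((φ.app a).hom x) :=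
  ConcreteCategory.congr_hom (φ.naturality f) x

lemma comp_app_apply (φ : F ⟶ G) (ψ : G ⟶ H) (a : 𝒜) (x : F.obj a) :
    ((φ ≫ ψ).app a).hom x = (ψ.app a).hom ((φ.app a).hom x) := rfl

lemma comp_eq_zero_iff (φ : F ⟶ G) (ψ : G ⟶ H) :
    φ ≫ ψ = 0 ↔ ∀ a x, (ψ.app a).hom ((φ.app a).hom x) = 0 := by
  constructor
  · intro h a x
    rw [← comp_app_apply, h]
    rfl
  · intro h
    ext a x
    exact h a x

lemma mono_iff_injective (φ : F ⟶ G) : Mono φ ↔ ∀ a, Function.Injective (φ.app a).hom := by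
  rw [NatTrans.mono_iff_mono_app]
  exact forall_congr' fun a => ModuleCat.mono_iff_injective _

lemma epi_iff_surjective (φ : F ⟶ G) : Epi φ ↔ ∀ a, Function.Surjective (φ.app a).hom := by
  rw [NatTrans.epi_iff_epi_app]
  exact forall_congr' fun a => ModuleCat.epi_iff_surjective _

lemma kernel_comp_eq_zero (u : F ⟶ G) (q : F ⟶ H)
    (h : ∀ a x, (u.app a).hom x = 0 → (q.app a).hom x = 0) : kernel.ι u ≫ q = 0 :=
  (comp_eq_zero_iff _ _).2 fun a x => h a _ ((comp_eq_zero_iff _ _).1 (kernel.condition u) a x)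

end FunctorElements

variable [Preadditive 𝒜]

section Linearization

variable {A B : 𝒜 ⥤+ AddCommGrpCat.{w}}

variable (k) in
/-- The morphism `k[A] ⟶ k[B]` induced by a morphism `A ⟶ B`. -/
def linHom (φ : A ⟶ B) : linearization k A ⟶ linearization k B :=
  Functor.whiskerRight φ.hom (forget AddCommGrpCat.{w} ⋙ ModuleCat.free k)

instance (φ : A ⟶ B) [Mono φ] : Mono (linHom k φ) :=
  (mono_iff_injective _).2 fun a => Finsupp.mapDomain_injective (addHom_injective_of_mono φ a)

instance (φ : A ⟶ B) [Epi φ] : Epi (linHom k φ) :=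
  (epi_iff_surjective _).2 fun a => Finsupp.mapDomain_surjective (addHom_surjective_of_epi φ a)

variable (k A) in
-- `B` is recovered from `k[B]`: the basis vector `[x]` lies in `k[B']` only if `x` lies in `B'`.
lemma mk_linHom_strictMono :
    StrictMono fun B : AddSubfunctor A => Subobject.mk (linHom k B.ι) := by
  refine strictMono_of_le_iff_le fun B B' => ⟨fun h => ?_, fun h a x hx => ?_⟩
  · obtain ⟨l, hl⟩ := exists_addHom_factor B'.ι B.ι
      (by rwa [AddSubfunctor.range_ι, AddSubfunctor.range_ι])
    refine Subobject.mk_le_mk_of_comm (linHom k l) ?_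
    rw [← hl]
    exact (Functor.whiskerRight_comp _ _ _).symm
  · have h1 := congrArg (fun t => (t.app a).hom (Finsupp.single (⟨x, hx⟩ : B.obj a) (1 : k)))
      (Subobject.ofMkLEMk_comp h)
    let y : B'.obj a →₀ k := ((Subobject.ofMkLEMk _ _ h).app a).hom
      (Finsupp.single (⟨x, hx⟩ : B.obj a) (1 : k))
    have h2 : Finsupp.mapDomain (B'.obj a).subtype y = Finsupp.single x (1 : k) :=
      h1.trans Finsupp.mapDomain_single
    by_contra hx'
    have h3 := DFunLike.congr_fun h2 x
    rw [Finsupp.mapDomain_of_notMem_range _ _ (by simpa using hx'), Finsupp.single_eq_same] at h3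
    exact zero_ne_one h3

lemma isFiniteLength_of_linearization (h : IsFiniteLength (linearization k A)) :
    IsFiniteLength A := by
  obtain ⟨_, _⟩ := (isFiniteLength_iff _).1 h
  have := mk_linHom_strictMono k A
  exact AddSubfunctor.isFiniteLength_iff.2 ⟨this.wellFoundedLT, this.wellFoundedGT⟩

lemma IsSubquotient.addFunctor_isFiniteLength (h : IsSubquotient B A) (hA : IsFiniteLength A) :
    IsFiniteLength B := by
  obtain ⟨Z, i, p, _, _⟩ := h
  obtain ⟨_, _⟩ := AddSubfunctor.isFiniteLength_iff.1 (hA.of_mono i)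
  have := AddSubfunctor.lift_strictMono (Z := (⊤ : AddSubfunctor Z))
    (p := (⊤ : AddSubfunctor Z).ι ≫ p) fun a y => by
      obtain ⟨z, rfl⟩ := addHom_surjective_of_epi p a y
      exact ⟨(⟨z, trivial⟩ : (⊤ : AddSubfunctor Z).obj a), rfl⟩
  exact AddSubfunctor.isFiniteLength_iff.2 ⟨this.wellFoundedLT, this.wellFoundedGT⟩

/-- The morphism `k[A] ⟶ M ⊗ Q_A` given by an element of `M`. -/
def linTo {M : Rep.{w} k (Aut A)} (m : M) : linearization k A ⟶ tensorLower M where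
  app a := ModuleCat.ofHom (X := A.obj.obj a →₀ k) (tmk M a m)
  naturality _ _ _ := rfl

end Linearization

/-! ### Simplicity of `Q(A, M)` -/

section Irreducible

variable {A : 𝒜 ⥤+ AddCommGrpCat.{w}}

lemma mem_of_isIrreducible {G V : Type*} [Group G] [AddCommGroup V] [Module k V]
    {ρ : Representation k G V} [ρ.IsIrreducible] (N : Submodule k V)
    (hN : ∀ g, ∀ v ∈ N, ρ g v ∈ N) {v : V} (hv : v ∈ N) (hv0 : v ≠ 0) (v' : V) : v' ∈ N := by
  let N' : Subrepresentation ρ := ⟨N, hN⟩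
  rcases eq_bot_or_eq_top N' with h | h
  · have : v ∈ (⊥ : Subrepresentation ρ) := by rw [← h]; exact hv
    exact (hv0 this).elim
  · have : v' ∈ N' := by rw [h]; trivial
    exact this

lemma exists_ne_zero_of_isIrreducible {G V : Type*} [Group G] [AddCommGroup V] [Module k V]
    (ρ : Representation k G V) [ρ.IsIrreducible] : ∃ v : V, v ≠ 0 := by
  by_contra! h
  refine bot_ne_top (α := Subrepresentation ρ) (SetLike.ext fun v => ?_)
  rw [h v]
  exact ⟨fun _ => trivial, fun _ => zero_mem (⊥ : Submodule k V)⟩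

/-- The `m'` with `m' ⊗ k[A]` contained in `m ⊗ k[A]` form a subrepresentation, because `gm' ⊗ x =
m' ⊗ g⁻¹x`; it contains `m ≠ 0`. -/
lemma linTo_epi {M : Rep.{w} k (Aut A)} [M.ρ.IsIrreducible] {m : M} (hm : m ≠ 0) :
    Epi (linTo m) := by
  refine (epi_iff_surjective _).2 fun a => ?_
  have key : ∀ m' : M, ∀ x, tmk M a m' x ∈ LinearMap.range (tmk M a m) := by
    let N : Submodule k M :=
      { carrier := {m' | ∀ x, tmk M a m' x ∈ LinearMap.range (tmk M a m)}
        add_mem' := fun h h' x => by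
          rw [map_add, LinearMap.add_apply]
          exact add_mem (h x) (h' x)
        zero_mem' := fun x => by
          rw [map_zero, LinearMap.zero_apply]
          exact zero_mem _
        smul_mem' := fun r m' h x => by
          rw [map_smul, LinearMap.smul_apply]
          exact Submodule.smul_mem _ r (h x) }
    refine mem_of_isIrreducible (ρ := M.ρ) N (fun g m' h x => ?_) (v := m) (fun x => ⟨x, rfl⟩) hm
    rw [← (linRep k A a).self_inv_apply g x, tmk_act]
    exact h _
  intro t
  change t ∈ LinearMap.range (tmk M a m)
  exact tensorLower_induction (p := fun t => t ∈ LinearMap.range (tmk M a m)) (zero_mem _)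
    (fun _ _ => add_mem) key t

lemma image_fac_apply (M : Rep.{w} k (Aut A)) (a : 𝒜) (x : (tensorUpper M).obj a) :
    ((image.ι (tensorHom M)).app a).hom (((factorThruImage (tensorHom M)).app a).hom x) =
      ((tensorHom M).app a).hom x := by
  rw [← comp_app_apply, image.fac]

variable [HasZeroObject 𝒜] [HasBinaryBiproducts 𝒜]

lemma tensorHom_ne_zero (h𝒜 : IsTrivialFor k 𝒜) (hA : IsFiniteLength A)
    {M : Rep.{w} k (Aut A)} {m : M} (hm : m ≠ 0) : tensorHom M ≠ 0 := by
  obtain ⟨_, _⟩ := AddSubfunctor.isFiniteLength_iff.1 hA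
  obtain ⟨a, x, hx⟩ := exists_isGenerator A
  obtain ⟨c, hc⟩ := exists_isCogenerating A
  have := hx.finite h𝒜 c
  obtain ⟨d, ζ, hζ, hζ0⟩ := exists_mem_quotKer_ne_zero k hc
  obtain ⟨ξ, hξ, hne⟩ := tmk_ne_zero (M := M) hx hζ hζ0 hm
  intro h0
  refine hne ?_
  have := (tensorHom_range (M := M) (N := ⊥)).1 (by
    rintro _ ⟨y, rfl⟩
    rw [h0]
    exact Submodule.zero_mem _) m ξ hξ
  exact this

/-- A nonzero subobject contains `m ⊗ Q^A` for some `m ≠ 0`, by separation of orbits. The `m'` with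
this property form a subrepresentation, hence all of `M`. -/
lemma simple_Q (h𝒜 : IsTrivialFor k 𝒜) (hA : IsFiniteLength A)
    (M : Rep.{w} k (Aut A)) [M.ρ.IsIrreducible] : Simple (Q M) := by
  obtain ⟨m₀, hm₀⟩ := exists_ne_zero_of_isIrreducible M.ρ
  have hne := tensorHom_ne_zero h𝒜 hA hm₀
  let ι : Q M ⟶ tensorLower M := image.ι (tensorHom M)
  let e : tensorUpper M ⟶ Q M := factorThruImage (tensorHom M)
  have hιe : e ≫ ι = tensorHom M := image.fac _
  have : Mono ι := inferInstanceAs (Mono (image.ι (tensorHom M)))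
  have : Epi e := inferInstanceAs (Epi (factorThruImage (tensorHom M)))
  refine ⟨fun {Y} j _ => ⟨fun _ h0 => hne ?_, fun hj => ?_⟩⟩
  · have h1 : inv j ≫ j = 0 := (congrArg (inv j ≫ ·) h0).trans comp_zero
    rw [← hιe, ← Category.comp_id e, ← IsIso.inv_hom_id j, h1, comp_zero, zero_comp]
  · obtain ⟨a, y, hy⟩ : ∃ a y, (j.app a).hom y ≠ 0 := by
      by_contra! h
      exact hj (by ext a y; exact h a y)
    have hι := (mono_iff_injective ι).1 inferInstance
    obtain ⟨_, _⟩ := AddSubfunctor.isFiniteLength_iff.1 hA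
    obtain ⟨a₀, x₀, hx₀⟩ := exists_isGenerator A
    obtain ⟨m, hm, hu⟩ := exists_sum_map_eq_tmk h𝒜 hx₀ (M := M)
      (t := ((j ≫ ι).app a).hom y) (by
        rw [comp_app_apply]
        exact fun h => hy (hι a (h.trans (map_zero _).symm)))
    have key : ∀ m' : M, ∀ b, ∀ ξ ∈ quotKer k A b,
        tmk M b m' ξ ∈ LinearMap.range ((j ≫ ι).app b).hom := by
      let N : Submodule k M :=
        { carrier := {m' | ∀ b, ∀ ξ ∈ quotKer k A b,
            tmk M b m' ξ ∈ LinearMap.range ((j ≫ ι).app b).hom}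
          add_mem' := fun h h' b ξ hξ => by
            rw [map_add, LinearMap.add_apply]
            exact add_mem (h b ξ hξ) (h' b ξ hξ)
          zero_mem' := fun b ξ _ => by
            rw [map_zero, LinearMap.zero_apply]
            exact zero_mem _
          smul_mem' := fun r m' h b ξ hξ => by
            rw [map_smul, LinearMap.smul_apply]
            exact Submodule.smul_mem _ r (h b ξ hξ) }
      refine mem_of_isIrreducible (ρ := M.ρ) N (fun g m' h b ξ hξ => ?_) (v := m)
        (fun b ξ hξ => ?_) hm
      · rw [← (linRep k A b).self_inv_apply g ξ, tmk_act]
        exact h b _ (quotKer_le_comap_linEnd k A g⁻¹ b hξ)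
      · obtain ⟨u, hu⟩ := hu b ξ hξ
        rw [← hu]
        refine Submodule.sum_mem _ fun f _ => Submodule.smul_mem _ _ ?_
        exact ⟨(Y.map f).hom y, natTrans_naturality_apply (j ≫ ι) f y⟩
    have : Epi j := by
      refine (epi_iff_surjective _).2 fun b q => ?_
      obtain ⟨z, rfl⟩ := (epi_iff_surjective e).1 inferInstance b q
      obtain ⟨y', hy'⟩ := tensorHom_range.2 (fun m' ξ hξ => key m' b ξ hξ) ⟨z, rfl⟩
      exact ⟨y', hι b (hy'.trans (image_fac_apply M b z).symm)⟩
    exact isIso_of_mono_of_epi j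

end Irreducible

/-! ### Dévissage of `k[A]` -/

section Devissage

variable {A : 𝒜 ⥤+ AddCommGrpCat.{w}} (P : ObjectProperty (𝒜 ⥤ ModuleCat.{w} k)) [P.IsSerreClass]

/-- Through `m ⊗ -`, the quotient of `M ⊗ Q_A` by `Q(A, M)` is a quotient of `k[A]` killing `Q^A`.
Every nonzero `B` contains the subfunctor generated by some nonzero `y ∈ A(c)`, so `Q^A` is already
cut out by the finitely many quotients by these subfunctors. -/
lemma prop_tensorLower_of_isIrreducible (M : Rep.{w} k (Aut A)) [M.ρ.IsIrreducible] {c : 𝒜}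
    (hc : IsCogenerating A c) [Finite (A.obj.obj c)] (hQ : P (Q M))
    (hquot : ∀ W : AddSubfunctor A, W.IsNonzero → P (linearization k W.quot)) :
    P (tensorLower M) := by
  let ι : Q M ⟶ tensorLower M := image.ι (tensorHom M)
  obtain ⟨m, hm⟩ := exists_ne_zero_of_isIrreducible M.ρ
  have := linTo_epi hm
  refine P.prop_X₂_of_exact (S := ShortComplex.mk ι (cokernel.π ι) (cokernel.condition ι))
    (ShortComplex.exact_cokernel ι) hQ ?_
  refine prop_of_family_to P (ι := {y : A.obj.obj c // y ≠ 0})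
    (Z := fun y => linearization k (AddSubfunctor.gen y.1).quot)
    (fun y => hquot _ ⟨c, fun h => y.2 ?_⟩)
    (fun y => linHom k (AddSubfunctor.gen y.1).π) (linTo m ≫ cokernel.π ι) fun K j hj => ?_
  · have := AddSubfunctor.self_mem_gen y.1
    rwa [h] at this
  · refine (comp_eq_zero_iff _ _).2 fun b z => ?_
    let x : A.obj.obj b →₀ k := (j.app b).hom z
    have hx : x ∈ quotKer k A b := by
      refine mem_quotKer_iff.2 fun B hB => ?_
      obtain ⟨y, hy, hy0⟩ := hB.exists_mem hc
      have h0 := (comp_eq_zero_iff _ _).1 (hj ⟨y, hy0⟩) b z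
      have h1 := lmapDomain_ker_le k (QuotientAddGroup.mk' ((AddSubfunctor.gen y).obj b))
        (QuotientAddGroup.mk' (B.obj b)) id
        (QuotientAddGroup.map _ _ (AddMonoidHom.id _) (AddSubfunctor.gen_le hy b))
        (fun _ => rfl) (show x ∈ _ from h0)
      rwa [Submodule.mem_comap, LinearMap.mem_ker, Finsupp.lmapDomain_apply,
        Finsupp.lmapDomain_apply, Finsupp.mapDomain_id] at h1
    obtain ⟨t, ht⟩ := (tensorHom_range (N := LinearMap.range ((tensorHom M).app b).hom)).1
      le_rfl m x hx
    rw [comp_app_apply]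
    change ((cokernel.π ι).app b).hom (tmk M b m x) = 0
    rw [← ht, ← image_fac_apply]
    exact (comp_eq_zero_iff _ _).1 (cokernel.condition ι) b _

/-- The functoriality of `M ⊗ Q_A` in `M`. -/
def tensorLowerMap {M M' : Rep.{w} k (Aut A)} (f : M ⟶ M') : tensorLower M ⟶ tensorLower M' :=
  Functor.whiskerLeft (Qlower k A) ((Rep.coinvariantsTensor k (Aut A)).map f)

/-- The functor `M ↦ M ⊗ Q_A` is right exact. -/
lemma mem_range_tensorLowerMap {M : Rep.{w} k (Aut A)} (N : Submodule k M)
    (hN : ∀ g, N ≤ N.comap (M.ρ g)) {a : 𝒜} {t : (tensorLower M).obj a}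
    (ht : ((tensorLowerMap (M.mkQ N hN)).app a).hom t = 0) :
    t ∈ LinearMap.range ((tensorLowerMap (M.subtype N hN)).app a).hom := by
  let R := LinearMap.range ((tensorLowerMap (M.subtype N hN)).app a).hom
  -- The projection of `M ⊗ Q_A` modulo `R` factors through `(M/N) ⊗ Q_A`, so whatever dies there
  -- lies in `R`.
  let β : (M ⧸ N) →ₗ[k] (A.obj.obj a →₀ k) →ₗ[k] ((tensorLower M).obj a ⧸ R) :=
    N.liftQ ((tmk M a).compr₂ R.mkQ) fun m hm => by
      refine LinearMap.ext fun x => (Submodule.Quotient.mk_eq_zero _).2 ?_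
      exact ⟨tmk (M.subrepresentation N hN) a (⟨m, hm⟩ : N) x, rfl⟩
  obtain ⟨φ, hφ⟩ := exists_tensorLower_lift (M := M.quotient N hN) (a := a) β
    (fun g m x => by
      obtain ⟨m, rfl⟩ := N.mkQ_surjective m
      exact congrArg R.mkQ (tmk_act a g m x))
    (fun m x hx => by
      obtain ⟨m, rfl⟩ := N.mkQ_surjective m
      exact (congrArg R.mkQ (tmk_eq_zero m hx)).trans (map_zero _))
  have h : φ ∘ₗ ((tensorLowerMap (M.mkQ N hN)).app a).hom = R.mkQ :=
    tensorLower_hom_ext fun m x => hφ (N.mkQ m) x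
  have h' := LinearMap.congr_fun h t
  rw [LinearMap.comp_apply, ht, map_zero] at h'
  exact (Submodule.Quotient.mk_eq_zero _).1 h'.symm

lemma exists_isIrreducible_subrepresentation {G V : Type*} [Group G] [AddCommGroup V] [Module k V]
    [Module.Finite k V] [Nontrivial V] (ρ : Representation k G V) :
    ∃ (N : Submodule k V) (hN : ∀ g, N ≤ N.comap (ρ g)), N ≠ ⊥ ∧
      (ρ.subrepresentation N hN).IsIrreducible := by
  classical
  have hex : ∃ (n : ℕ) (N : Submodule k V), (∀ g, N ≤ N.comap (ρ g)) ∧ N ≠ ⊥ ∧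
      Module.finrank k N = n := ⟨_, ⊤, fun _ => le_rfl, top_ne_bot, rfl⟩
  obtain ⟨N, hN, hN0, hn⟩ := Nat.find_spec hex
  refine ⟨N, hN, hN0, ?_⟩
  obtain ⟨v, hv, hv0⟩ := Submodule.exists_mem_ne_zero_of_ne_bot hN0
  refine @IsSimpleOrder.mk _ _ _ ⟨⊥, ⊤, fun h => hv0 ?_⟩ fun L => ?_
  · have : (⟨v, hv⟩ : N) ∈ (⊥ : Subrepresentation (ρ.subrepresentation N hN)) := by
      rw [h]; trivial
    exact congrArg Subtype.val (show (⟨v, hv⟩ : N) = 0 from this)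
  · by_cases hL : L.toSubmodule = ⊥
    · exact Or.inl (Subrepresentation.toSubmodule_injective hL)
    · refine Or.inr (Subrepresentation.toSubmodule_injective ?_)
      refine Submodule.eq_top_of_finrank_eq (le_antisymm (Submodule.finrank_le _) ?_)
      rw [hn, ← Submodule.finrank_map_subtype_eq]
      refine Nat.find_min' hex ⟨L.toSubmodule.map N.subtype, ?_, ?_, rfl⟩
      · rintro g _ ⟨x, hx, rfl⟩
        exact ⟨_, L.apply_mem_toSubmodule g hx, rfl⟩
      · exact fun h => hL (Submodule.map_injective_of_injective N.injective_subtype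
          (h.trans (Submodule.map_bot _).symm))

/-- Induction on dimension, splitting off an irreducible subrepresentation. Right exactness is
enough, since only the image of the left-hand term matters. -/
lemma prop_tensorLower_of_finite
    (hP : ∀ M : Rep.{w} k (Aut A), M.ρ.IsIrreducible → P (tensorLower M))
    (M : Rep.{w} k (Aut A)) [Module.Finite k M] : P (tensorLower M) := by
  obtain ⟨n, hn⟩ : ∃ n, Module.finrank k M = n := ⟨_, rfl⟩
  induction n using Nat.strong_induction_on generalizing M with
  | _ n ih =>
    rcases subsingleton_or_nontrivial M with _ | _
    · refine P.prop_of_isZero ((IsZero.iff_id_eq_zero _).2 ?_)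
      ext a t
      refine tensorLower_induction (p := fun t => t = 0) rfl (fun s t hs ht => ?_)
        (fun m x => ?_) t
      · rw [hs, ht, add_zero]
      · rw [Subsingleton.elim m 0, map_zero, LinearMap.zero_apply]
    · obtain ⟨N, hN, hN0, hirr⟩ := exists_isIrreducible_subrepresentation M.ρ
      have hfin : Module.Finite k (M.quotient N hN) :=
        inferInstanceAs (Module.Finite k (M ⧸ N))
      have hlt : Module.finrank k (M ⧸ N) < n := by
        rw [← hn, ← N.finrank_quotient_add_finrank]
        have : 0 < Module.finrank k N := by
          have := Submodule.nontrivial_iff_ne_bot.2 hN0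
          exact Module.finrank_pos
        omega
      have h₃ : P (tensorLower (M.quotient N hN)) := ih _ hlt _ rfl
      have h₁ : P (tensorLower (M.subrepresentation N hN)) := hP _ hirr
      refine prop_of_family_from P (ι := Unit) (fun _ => h₁)
        (fun _ => tensorLowerMap (M.subtype N hN)) fun T g _ hg => ?_
      refine prop_of_kernel_comp_eq_zero P (tensorLowerMap (M.mkQ N hN)) g
        (kernel_comp_eq_zero _ _ fun a t ht => ?_) h₃
      obtain ⟨s, rfl⟩ := mem_range_tensorLowerMap N hN ht
      exact (comp_eq_zero_iff _ _).1 (hg ()) a s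

/-- The largest subfunctor whose value at `a` is contained in `H`. -/
def AddSubfunctor.largest {a : 𝒜} (H : AddSubgroup (A.obj.obj a)) : AddSubfunctor A where
  obj b := ⨅ f : b ⟶ a, H.comap (A.obj.map f).hom
  map_mem {b c} f {x} hx := by
    simp only [AddSubgroup.mem_iInf, AddSubgroup.mem_comap] at hx ⊢
    intro g
    rw [← map_comp_apply]
    exact hx _

lemma AddSubfunctor.mem_largest {a b : 𝒜} {H : AddSubgroup (A.obj.obj a)} {x : A.obj.obj b} :
    x ∈ (AddSubfunctor.largest H).obj b ↔ ∀ f : b ⟶ a, (A.obj.map f).hom x ∈ H := by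
  simp [AddSubfunctor.largest, AddSubgroup.mem_iInf]

/-- There may be infinitely many proper subfunctors `C`, but each satisfies `C(a) ≠ A(a)` and lies
in the largest subfunctor whose value at `a` is contained in `C(a)`. Only finitely many subgroups of
`A(a)` occur, so finitely many proper subfunctors suffice to pass from `k[A]` to `Q_A`, which embeds
in `k[A(a)] ⊗ Q_A`. -/
lemma prop_linearization {a : 𝒜} {x : A.obj.obj a} (hx : IsGenerator x) [Finite (A.obj.obj a)]
    (hsub : ∀ W : AddSubfunctor A, W.IsProper → P (linearization k W.toFunctor))
    (hP : ∀ M : Rep.{w} k (Aut A), M.ρ.IsIrreducible → P (tensorLower M)) :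
    P (linearization k A) := by
  refine prop_of_family_from P (ι := {H : AddSubgroup (A.obj.obj a) // H ≠ ⊤})
    (Z := fun H => linearization k (AddSubfunctor.largest H.1).toFunctor)
    (fun H => hsub _ ⟨a, fun h => H.2 ((AddSubgroup.eq_top_iff' _).2 fun y => ?_)⟩)
    (fun H => linHom k (AddSubfunctor.largest H.1).ι) fun T g _ hg => ?_
  · have := AddSubfunctor.mem_largest.1 ((AddSubgroup.eq_top_iff' _).1 h y) (𝟙 a)
    rwa [map_id_apply] at this
  · let M : Rep.{w} k (Aut A) := Rep.of (linRep k A a)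
    have : Module.Finite k M := inferInstanceAs (Module.Finite k (A.obj.obj a →₀ k))
    refine prop_of_kernel_comp_eq_zero P (linTo (M := M) (Finsupp.single x 1)) g
      (kernel_comp_eq_zero _ _ fun b y hy => ?_) (prop_tensorLower_of_finite P hP M)
    have hy' := mem_properSum_of_tmk_single_eq_zero hx hy
    suffices h : properSum k A b ≤ LinearMap.ker (g.app b).hom from h hy'
    refine iSup₂_le fun C hC => ?_
    have hCa : C.obj a ≠ ⊤ := fun h => isGenerator_iff.1 hx C hC (by rw [h]; trivial)
    rintro _ ⟨z, rfl⟩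
    have hle : C.obj b ≤ (AddSubfunctor.largest (C.obj a)).obj b := fun y hy =>
      AddSubfunctor.mem_largest.2 fun f => C.map_mem f hy
    have h0 := (comp_eq_zero_iff _ _).1 (hg ⟨C.obj a, hCa⟩) b
      (Finsupp.mapDomain (AddSubgroup.inclusion hle) z)
    have h1 : Finsupp.mapDomain (((AddSubfunctor.largest (C.obj a)).obj b).subtype)
        (Finsupp.mapDomain (AddSubgroup.inclusion hle) z) =
          Finsupp.mapDomain (C.obj b).subtype z := by
      rw [← Finsupp.mapDomain_comp]
      rfl
    exact (congrArg (g.app b).hom h1.symm).trans h0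

end Devissage

/-! ### Composition factors of `k[A]` -/

section Main

variable (k) in
/-- `S` is isomorphic to `Q(B, M)` for some subquotient `B` of `A` and some simple `M`. -/
def IsQFactor (A : 𝒜 ⥤+ AddCommGrpCat.{w}) (S : 𝒜 ⥤ ModuleCat.{w} k) : Prop :=
  ∃ (B : 𝒜 ⥤+ AddCommGrpCat.{w}) (M : Rep.{w} k (Aut B)),
    IsSubquotient B A ∧ M.ρ.IsIrreducible ∧ Nonempty (S ≅ Q M)

variable {A : 𝒜 ⥤+ AddCommGrpCat.{w}}

lemma Q_isSubquotient_linearization (M : Rep.{w} k (Aut A)) [M.ρ.IsIrreducible] :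
    IsSubquotient (Q M) (linearization k A) := by
  obtain ⟨m, hm⟩ := exists_ne_zero_of_isIrreducible M.ρ
  have := linTo_epi hm
  have : IsSubquotient (Q M) (tensorLower M) :=
    ⟨Q M, image.ι (tensorHom M), 𝟙 _, inferInstanceAs (Mono (image.ι (tensorHom M))), inferInstance⟩
  exact this.of_epi_right (linTo m)

lemma IsSubquotient.linearization {B : 𝒜 ⥤+ AddCommGrpCat.{w}} (h : IsSubquotient B A)
    {S : 𝒜 ⥤ ModuleCat.{w} k} (hS : IsSubquotient S (linearization k B)) :
    IsSubquotient S (AddRepLin.linearization k A) := by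
  obtain ⟨Z, i, p, _, _⟩ := h
  exact (hS.of_epi_right (linHom k p)).of_mono (linHom k i)

variable [HasZeroObject 𝒜] [HasBinaryBiproducts 𝒜]

/-- The Serre class is fixed by the ambient `A` while the induction runs over its subquotients `B`;
the new simple factors at each stage are the `Q(B, M)`. -/
lemma finiteLengthWithFactors_linearization (h𝒜 : IsTrivialFor k 𝒜) (hA : IsFiniteLength A) :
    finiteLengthWithFactors (IsQFactor k A) (linearization k A) := by
  obtain ⟨_, _⟩ := AddSubfunctor.isFiniteLength_iff.1 hA
  refine AddSubfunctor.subquotient_induction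
    (fun B => finiteLengthWithFactors (IsQFactor k A) (linearization k B))
    fun B hBA hB hsub hquot => ?_
  obtain ⟨_, _⟩ := AddSubfunctor.isFiniteLength_iff.1 hB
  obtain ⟨a, x, hx⟩ := exists_isGenerator B
  obtain ⟨c, hc⟩ := exists_isCogenerating B
  have := hx.finite h𝒜
  refine prop_linearization _ hx hsub fun M _ => ?_
  have := simple_Q h𝒜 hB M
  refine prop_tensorLower_of_isIrreducible _ M hc ?_ hquot
  exact finiteLengthWithFactors_of_simple fun T hT => ⟨B, M, hBA, inferInstance, hT⟩

end Main

end AddRepLin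

end

theorem mainTheorem5 (k : Type w) [Field k]
    (𝒜 : Type u) [Category.{v} 𝒜] [EssentiallySmall.{w} 𝒜] [Preadditive 𝒜] [HasFiniteBiproducts 𝒜]
    (h𝒜 : AddRepLin.IsTrivialFor k 𝒜) (A : 𝒜 ⥤+ AddCommGrpCat.{w}) :
    (AddRepLin.IsFiniteLength (AddRepLin.linearization k A) ↔ AddRepLin.IsFiniteLength A) ∧
    (AddRepLin.IsFiniteLength A →
      ∀ S : 𝒜 ⥤ ModuleCat.{w} k,
        AddRepLin.IsCompositionFactor S (AddRepLin.linearization k A) ↔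
          ∃ (B : 𝒜 ⥤+ AddCommGrpCat.{w}) (M : Rep.{w} k (Aut B)),
            AddRepLin.IsSubquotient B A ∧ M.ρ.IsIrreducible ∧
              Nonempty (S ≅ AddRepLin.Q M)) := by
  have : HasZeroObject 𝒜 := hasZeroObject_of_hasFiniteBiproducts 𝒜
  have : HasBinaryBiproducts 𝒜 := hasBinaryBiproducts_of_finite_biproducts 𝒜
  have key := fun hA => AddRepLin.finiteLengthWithFactors_linearization (A := A) h𝒜 hA
  refine ⟨⟨AddRepLin.isFiniteLength_of_linearization, fun hA => (key hA).1⟩, fun hA S => ⟨?_, ?_⟩⟩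
  · intro hS
    obtain ⟨hS', hSA⟩ := hS.simple_and_isSubquotient
    exact (key hA).2 S hS' hSA
  · rintro ⟨B, M, hBA, hM, ⟨e⟩⟩
    have := AddRepLin.simple_Q h𝒜 (hBA.addFunctor_isFiniteLength hA) M
    have := Simple.of_iso e
    exact (hBA.linearization
      ((AddRepLin.Q_isSubquotient_linearization M).of_epi e.inv)).isCompositionFactor (key hA).1
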